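/- **The change of volume.** Let a fluid fill an open set $D\subseteq\mathbb R^3$ at time $0$, and let its motion be $x=x(\xi,t)$, $\xi\in D$, $t\in\mathbb R$, where $x(\cdot,\cdot)$ is three times continuously differentiable on $D\times\mathbb R$, $x(\xi,0)=\xi$, and for each $t$ the map $\xi\mapsto x(\xi,t)$ is injective on $D$ with Jacobian determinant nowhere zero. Let $u(\cdot,t)$ be the Eulerian velocity field on $\{x(\xi,t):\xi\in D\}$, defined by $u(x(\xi,t),t)=\partial x(\xi,t)/\partial t$. Let $\Sigma_0\subset D$ be compact, let $\Sigma(t)=\{x(\xi,t):\xi\in\Sigma_0\}$ be the region moving with the fluid, and let $V_\Sigma(t)=\int_{\Sigma(t)}dV$ be its volume. Then for every $t\in\mathbb R$ the function $\operatorname{div}u(\cdot,t)$ is integrable on $\Sigma(t)$, $V_\Sigma$ is differentiable at $t$, and $$\frac{d}{dt}V_\Sigma(t)=\int_{\Sigma(t)}\frac{\partial u^k}{\partial x^k}\,dV .$$ Call the boundary of a compact set $K\subset\mathbb R^3$ piecewise $C^1$ if $\partial K$ has finite area (two-dimensional Hausdorff measure) and all points $p\in\partial K$ outside a set of zero area are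 regular, i.e. near $p$ one has $K=\{g\le 0\}$ for some $C^1$ function $g$ with $g(p)=0$ and $\nabla g(p)\ne0$; the outward unit normal at $p$ is then $n(p)=\nabla g(p)/|\nabla g(p)|$. If $\partial\Sigma_0$ is piecewise $C^1$, then for every $t$ the boundary of $\Sigma(t)$ is piecewise $C^1$, $u\cdot n$ is integrable on $\partial\Sigma(t)$ with respect to area, and $$\frac{d}{dt}V_\Sigma(t)=\int_{\Sigma(t)}\frac{\partial u^k}{\partial x^k}\,dV=\oint_{\partial\Sigma(t)}u\cdot n\,dS .$$ -/

import Mathlib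

open MeasureTheory Set Topology

noncomputable section

/-- Euclidean 3-space with its Cartesian coordinates. -/
abbrev Space3 : Type := EuclideanSpace ℝ (Fin 3)

/-- The divergence `∂vᵏ/∂xᵏ` of a vector field. -/
def divergence (v : Space3 → Space3) (x : Space3) : ℝ :=
  ∑ k : Fin 3, (fderiv ℝ v x (EuclideanSpace.single k 1)) k

/-! ### Boundary of a region, outward normal, flux -/

/-- `g` is a local `C¹` defining function of the region `K` at `p`: near `p` the region is
`{g ≤ 0}`, with `g p = 0` and `∇ g p ≠ 0`. Such a `p` is a boundary point of `K`, and near `p` the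
region lies on exactly one side of the `C¹` surface `{g = 0}`. -/
structure IsLocalDefiningFunction (K : Set Space3) (p : Space3) (g : Space3 → ℝ) : Prop where
  contDiffAt : ContDiffAt ℝ 1 g p
  map_eq_zero : g p = 0
  gradient_ne_zero : gradient g p ≠ 0
  mem_iff : ∀ᶠ x in 𝓝 p, (x ∈ K ↔ g x ≤ 0)

/-- The regular part of the boundary of `K`. -/
def regularBoundary (K : Set Space3) : Set Space3 :=
  {p | ∃ g, IsLocalDefiningFunction K p g}

/-- `ν` is the outward unit normal of `K` at the regular boundary point `p`. -/
def IsOutwardUnitNormal (K : Set Space3) (p ν : Space3) : Prop :=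
  ∃ g, IsLocalDefiningFunction K p g ∧ ν = ‖gradient g p‖⁻¹ • gradient g p

open Classical in
/-- The outward unit normal of `K` at its regular boundary points (and `0` elsewhere). -/
def outwardUnitNormal (K : Set Space3) (p : Space3) : Space3 :=
  if h : ∃ ν, IsOutwardUnitNormal K p ν then h.choose else 0

/-- The boundary of `K` is piecewise `C¹`: it has finite area, and it is a `C¹` surface with `K` on
one side, apart from a set of zero area (edges, corners, cusps, ...). Area is the two-dimensional
Hausdorff measure `μHE[2]`, normalised to agree with Lebesgue measure in the plane. -/
structure HasPiecewiseC1Boundary (K : Set Space3) : Prop where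
  area_lt_top : μHE[2] (frontier K) < ⊤
  area_singular : μHE[2] (frontier K \ regularBoundary K) = 0

/-- The flux `∮_{∂K} v · dS` of `v` out of `K`. -/
def boundaryFlux (K : Set Space3) (v : Space3 → Space3) : ℝ :=
  ∫ x in frontier K, inner ℝ (v x) (outwardUnitNormal K x) ∂μHE[2]

/-! ### Fluid motions -/

/-- The motion of a fluid that fills the region `domain` at time `0`: `pos ξ t` is the position at
time `t` of the particle that is at `ξ` at time `0`. -/
structure FluidMotion where
  domain : Set Space3
  isOpen_domain : IsOpen domain
  pos : Space3 → ℝ → Space3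
  contDiffOn : ContDiffOn ℝ 3 (fun p : Space3 × ℝ => pos p.1 p.2) (domain ×ˢ univ)
  pos_zero : ∀ ξ ∈ domain, pos ξ 0 = ξ
  injOn : ∀ t, InjOn (fun ξ => pos ξ t) domain
  jacobian_ne_zero : ∀ ξ ∈ domain, ∀ t, (fderiv ℝ (fun η => pos η t) ξ).det ≠ 0

namespace FluidMotion

/-- The initial position `ξ(x, t)` of the particle that is at `x` at time `t`. -/
def label (F : FluidMotion) (t : ℝ) (x : Space3) : Space3 :=
  Function.invFunOn (fun ξ => F.pos ξ t) F.domain x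

/-- The Eulerian velocity field `u(x, t)`: the velocity `∂x(ξ, t)/∂t`, with `ξ` fixed, of the
particle that is at `x` at time `t`. -/
def velocity (F : FluidMotion) (t : ℝ) (x : Space3) : Space3 :=
  deriv (fun s => F.pos (F.label t x) s) t

/-- The region `Σ(t)` moving with the fluid which is `S` at time `0`. -/
def region (F : FluidMotion) (S : Set Space3) (t : ℝ) : Set Space3 :=
  (fun ξ => F.pos ξ t) '' S

/-- The volume `V_Σ(t) = ∫_{Σ(t)} dV` of the moving region. -/
def regionVolume (F : FluidMotion) (S : Set Space3) (t : ℝ) : ℝ :=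
  ∫ _ in F.region S t, (1 : ℝ)

theorem label_pos (F : FluidMotion) {ξ : Space3} (hξ : ξ ∈ F.domain) (t : ℝ) :
    F.label t (F.pos ξ t) = ξ :=
  (F.injOn t).leftInvOn_invFunOn hξ

theorem velocity_pos (F : FluidMotion) {ξ : Space3} (hξ : ξ ∈ F.domain) (t : ℝ) :
    F.velocity t (F.pos ξ t) = deriv (fun s => F.pos ξ s) t := by
  simp only [velocity, F.label_pos hξ]

end FluidMotion

/-- The outward unit normal does not depend on the defining function. -/
theorem IsOutwardUnitNormal.unique {K : Set Space3} {p ν₁ ν₂ : Space3}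
    (h₁ : IsOutwardUnitNormal K p ν₁) (h₂ : IsOutwardUnitNormal K p ν₂) : ν₁ = ν₂ := by
  obtain ⟨g₁, d₁, rfl⟩ := h₁
  obtain ⟨g₂, d₂, rfl⟩ := h₂
  have key : ∀ v : Space3, inner ℝ (gradient g₁ p) v < 0 → inner ℝ (gradient g₂ p) v ≤ 0 := by
    intro v hv
    have line : HasDerivAt (fun s : ℝ => p + s • v) v 0 := by
      simpa using ((hasDerivAt_id (0 : ℝ)).smul_const v).const_add p
    have comp : ∀ g : Space3 → ℝ, IsLocalDefiningFunction K p g →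
        HasDerivAt (fun s : ℝ => g (p + s • v)) (inner ℝ (gradient g p) v) 0 := by
      intro g d
      have hg := (d.contDiffAt.differentiableAt one_ne_zero).hasGradientAt.hasFDerivAt
      have hg' : HasFDerivAt g (InnerProductSpace.toDual ℝ Space3 (gradient g p))
          (p + (0 : ℝ) • v) := by simpa using hg
      simpa [Function.comp_def] using hg'.comp_hasDerivAt (0 : ℝ) line
    have t0 : Filter.Tendsto (fun s : ℝ => p + s • v) (𝓝[>] 0) (𝓝 p) := by
      have := line.continuousAt.tendsto.mono_left (nhdsWithin_le_nhds (s := Ioi (0 : ℝ)))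
      simpa using this
    have neg : ∀ᶠ s : ℝ in 𝓝[>] 0, g₁ (p + s • v) < 0 := by
      have h := (hasDerivAt_iff_tendsto_slope.1 (comp g₁ d₁)).mono_left
        (nhdsWithin_mono 0 (fun s (hs : 0 < s) => ne_of_gt hs) : 𝓝[>] (0 : ℝ) ≤ _)
      filter_upwards [h.eventually (gt_mem_nhds hv), self_mem_nhdsWithin] with s hs hpos
      have hpos' : (0 : ℝ) < s := hpos
      simp only [slope_def_field, zero_smul, add_zero, d₁.map_eq_zero, sub_zero] at hs
      by_contra hc
      exact absurd hs (not_lt.2 (div_nonneg (not_lt.1 hc) hpos'.le))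
    have h := (hasDerivAt_iff_tendsto_slope.1 (comp g₂ d₂)).mono_left
        (nhdsWithin_mono 0 (fun s (hs : 0 < s) => ne_of_gt hs) : 𝓝[>] (0 : ℝ) ≤ _)
    refine le_of_tendsto h ?_
    filter_upwards [neg, t0.eventually d₁.mem_iff, t0.eventually d₂.mem_iff,
      self_mem_nhdsWithin] with s hs h1 h2 hpos
    have hpos' : (0 : ℝ) < s := hpos
    simp only [slope_def_field, zero_smul, add_zero, d₂.map_eq_zero, sub_zero]
    exact div_nonpos_of_nonpos_of_nonneg (h2.1 (h1.2 hs.le)) hpos'.le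
  set a := gradient g₁ p
  set b := gradient g₂ p
  have ha : 0 < ‖a‖ := norm_pos_iff.2 d₁.gradient_ne_zero
  have hb : 0 < ‖b‖ := norm_pos_iff.2 d₂.gradient_ne_zero
  have na : ‖‖a‖⁻¹ • a‖ = 1 := by simp [norm_smul, ha.ne']
  have nb : ‖‖b‖⁻¹ • b‖ = 1 := by simp [norm_smul, hb.ne']
  set m := ‖a‖⁻¹ • a with hm
  set n := ‖b‖⁻¹ • b with hn
  have ea : a = ‖a‖ • m := by rw [hm, smul_inv_smul₀ ha.ne']
  have eb : b = ‖b‖ • n := by rw [hn, smul_inv_smul₀ hb.ne']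
  by_contra hne
  have hlt : inner ℝ m n < 1 := (inner_lt_one_iff_real_of_norm_eq_one na nb).2 hne
  have h1 : inner ℝ a (n - m) < 0 := by
    rw [ea, real_inner_smul_left, inner_sub_right, real_inner_self_eq_norm_sq, na]
    nlinarith
  have h2 := key _ h1
  rw [eb, real_inner_smul_left, inner_sub_right, real_inner_self_eq_norm_sq, nb,
    real_inner_comm] at h2
  nlinarith

theorem outwardUnitNormal_eq {K : Set Space3} {p ν : Space3} (h : IsOutwardUnitNormal K p ν) :
    outwardUnitNormal K p = ν := by
  have hex : ∃ ν, IsOutwardUnitNormal K p ν := ⟨ν, h⟩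
  rw [outwardUnitNormal, dif_pos hex]
  exact hex.choose_spec.unique h

end

noncomputable section

/-- Lipschitz maps increase area by at most the square of the Lipschitz constant. -/
theorem area_image_le {X Y : Type*} [EMetricSpace X] [MeasurableSpace X] [BorelSpace X]
    [EMetricSpace Y] [MeasurableSpace Y] [BorelSpace Y] {f : X → Y} {s : Set X} {c : NNReal}
    (h : LipschitzOnWith c f s) : μHE[2] (f '' s) ≤ (c : ENNReal) ^ 2 * μHE[2] s := by
  have h1 := h.hausdorffMeasure_image_le (d := (2 : ℕ)) (by norm_num)
  rw [Measure.euclideanHausdorffMeasure_def, Measure.euclideanHausdorffMeasure_def]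
  simp only [Measure.smul_apply, ENNReal.smul_def, smul_eq_mul]
  rw [mul_left_comm]
  gcongr
  simpa using h1

theorem area_eq_zero_iff {X : Type*} [EMetricSpace X] [MeasurableSpace X] [BorelSpace X]
    {s : Set X} : μHE[2] s = 0 ↔ μH[2] s = 0 := by
  rw [Measure.euclideanHausdorffMeasure_def, Measure.smul_apply, ENNReal.smul_def, smul_eq_mul,
    mul_eq_zero, ENNReal.coe_eq_zero,
    or_iff_right (Measure.addHaarScalarFactor_volume_hausdorffMeasure_ne_zero 2), Nat.cast_ofNat]

/-- Sets of finite area in space have zero volume. -/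
theorem volume_eq_zero_of_area_lt_top {s : Set Space3} (hs : μHE[2] s < ⊤) : volume s = 0 := by
  rw [← EuclideanSpace.euclideanHausdorffMeasure_eq_volume]
  exact (Measure.euclideanHausdorffMeasure_zero_or_top (by norm_num : 2 < 3) s).resolve_right hs.ne

theorem abs_integral_sub_integral_le {X : Type*} [MeasurableSpace X] {l m : Measure X}
    {c : NNReal} (hlm : l ≤ c • m) (hml : m ≤ c • l) {f : X → ℝ}
    (hl : Integrable f l) (hm : Integrable f m) (hc : 1 ≤ c) :
    |∫ x, f x ∂l - ∫ x, f x ∂m| ≤ (c - 1) * ∫ x, |f x| ∂m := by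
  have hc' : (1 : ℝ) ≤ c := by exact_mod_cast hc
  have nonneg : ∀ g : X → ℝ, (∀ x, 0 ≤ g x) → Integrable g l → Integrable g m →
      |∫ x, g x ∂l - ∫ x, g x ∂m| ≤ (c - 1) * ∫ x, g x ∂m := by
    intro g hg il im
    have h1 : ∫ x, g x ∂l ≤ c * ∫ x, g x ∂m := by
      have := integral_mono_measure hlm (ae_of_all _ hg) (im.smul_measure_nnreal (c := c))
      rwa [integral_smul_nnreal_measure, NNReal.smul_def, smul_eq_mul] at this
    have h2 : ∫ x, g x ∂m ≤ c * ∫ x, g x ∂l := by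
      have := integral_mono_measure hml (ae_of_all _ hg) (il.smul_measure_nnreal (c := c))
      rwa [integral_smul_nnreal_measure, NNReal.smul_def, smul_eq_mul] at this
    have h3 : 0 ≤ ∫ x, g x ∂m := integral_nonneg hg
    have h4 : 0 ≤ ∫ x, g x ∂l := integral_nonneg hg
    rw [abs_le]
    constructor
    · nlinarith [mul_nonneg (sub_nonneg.2 hc') h3, mul_nonneg (sub_nonneg.2 hc') h4]
    · linarith
  have hp := nonneg (fun x => max (f x) 0) (fun x => le_max_right _ _) hl.pos_part hm.pos_part
  have hn := nonneg (fun x => max (-f x) 0) (fun x => le_max_right _ _) hl.neg_part hm.neg_part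
  have e : ∀ x, f x = max (f x) 0 - max (-f x) 0 := fun x => by
    rcases le_total (f x) 0 with h | h <;> simp [h]
  have e' : ∀ x, |f x| = max (f x) 0 + max (-f x) 0 := fun x => by
    rcases le_total (f x) 0 with h | h <;> simp [h, abs_of_nonneg, abs_of_nonpos]
  have il : ∫ x, f x ∂l = ∫ x, max (f x) 0 ∂l - ∫ x, max (-f x) 0 ∂l := by
    rw [← integral_sub hl.pos_part hl.neg_part]; exact integral_congr_ae (ae_of_all _ e)
  have im : ∫ x, f x ∂m = ∫ x, max (f x) 0 ∂m - ∫ x, max (-f x) 0 ∂m := by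
    rw [← integral_sub hm.pos_part hm.neg_part]; exact integral_congr_ae (ae_of_all _ e)
  have ia : ∫ x, |f x| ∂m = ∫ x, max (f x) 0 ∂m + ∫ x, max (-f x) 0 ∂m := by
    rw [← integral_add hm.pos_part hm.neg_part]; exact integral_congr_ae (ae_of_all _ e')
  rw [il, im, ia, abs_le]
  rw [abs_le] at hp hn
  constructor <;> linarith [hp.1, hp.2, hn.1, hn.2]

/-- A bi-Lipschitz projection of a surface `M` to the plane distorts area by little. -/
theorem area_compare {M : Set Space3} (hM : MeasurableSet M) {Y : Space3 → EuclideanSpace ℝ (Fin 2)}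
    (hY : Continuous Y) {c : NNReal} (h1 : LipschitzOnWith c Y M)
    (h2 : ∀ x ∈ M, ∀ x' ∈ M, dist x x' ≤ c * dist (Y x) (Y x')) :
    volume.restrict (Y '' M) ≤ (c ^ 2) • (μHE[2].restrict M).map Y ∧
      (μHE[2].restrict M).map Y ≤ (c ^ 2) • volume.restrict (Y '' M) := by
  have inj : InjOn Y M := fun x hx x' hx' he => by
    have := h2 x hx x' hx'
    rw [he, dist_self, mul_zero] at this
    exact dist_le_zero.1 this
  have hYM : MeasurableSet (Y '' M) := hM.image_of_measurable_injOn hY.measurable inj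
  have vol : (volume : Measure (EuclideanSpace ℝ (Fin 2))) = μHE[2] :=
    (EuclideanSpace.euclideanHausdorffMeasure_eq_volume 2).symm
  constructor
  · refine Measure.le_iff.2 fun A hA => ?_
    rw [Measure.smul_apply, Measure.map_apply hY.measurable hA, Measure.restrict_apply hA,
      Measure.restrict_apply (hY.measurable hA), vol,
      show A ∩ Y '' M = Y '' (Y ⁻¹' A ∩ M) by rw [inter_comm, ← image_inter_preimage, inter_comm]]
    simpa [ENNReal.smul_def] using area_image_le (h1.mono inter_subset_right)
  · refine Measure.le_iff.2 fun A hA => ?_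
    rw [Measure.smul_apply, Measure.map_apply hY.measurable hA, Measure.restrict_apply hA,
      Measure.restrict_apply (hY.measurable hA), vol]
    have h3 : LipschitzOnWith c (Function.invFunOn Y M) (A ∩ Y '' M) := by
      refine LipschitzOnWith.of_dist_le_mul ?_
      rintro _ ⟨-, x, hx, rfl⟩ _ ⟨-, x', hx', rfl⟩
      rw [inj.leftInvOn_invFunOn hx, inj.leftInvOn_invFunOn hx']
      exact h2 x hx x' hx'
    have h4 : Y ⁻¹' A ∩ M ⊆ Function.invFunOn Y M '' (A ∩ Y '' M) := fun x hx =>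
      ⟨Y x, ⟨hx.1, mem_image_of_mem _ hx.2⟩, inj.leftInvOn_invFunOn hx.2⟩
    simpa [ENNReal.smul_def] using (measure_mono h4).trans (area_image_le h3)

/-- The fundamental theorem of calculus on a half line cut out by an increasing function. -/
theorem setIntegral_deriv_of_strictMonoOn {F h : ℝ → ℝ} {J T : Set ℝ} (hF : ContDiff ℝ 1 F)
    (hc : HasCompactSupport F) (hJ : OrdConnected J) (hFJ : ∀ s ∉ J, deriv F s = 0)
    (hh : StrictMonoOn h J) (hhc : ContinuousOn h J) (hT : MeasurableSet T)
    (hTJ : ∀ s ∈ J, (s ∈ T ↔ h s ≤ 0)) :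
    (∀ s ∈ J, h s = 0 → ∫ r in T, deriv F r = F s) ∧
      ((∀ s ∈ J, h s ≠ 0) → ∫ r in T, deriv F r = 0) := by
  constructor
  · intro s hs h0
    rw [← HasCompactSupport.integral_Iic_deriv_eq hF hc s, ← integral_indicator hT,
      ← integral_indicator measurableSet_Iic]
    congr 1
    ext r
    by_cases hr : r ∈ J
    · have : r ∈ T ↔ r ∈ Iic s := by
        rw [hTJ r hr, ← h0, hh.le_iff_le hr hs, mem_Iic]
      by_cases h' : r ∈ T
      · rw [indicator_of_mem h', indicator_of_mem (this.1 h')]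
      · rw [indicator_of_notMem h', indicator_of_notMem (fun h => h' (this.2 h))]
    · simp [indicator, hFJ r hr]
  · intro hne
    by_cases hex : ∃ s ∈ J, h s < 0
    · obtain ⟨s, hs, hneg⟩ := hex
      have hall : ∀ r ∈ J, r ∈ T := by
        intro r hr
        rw [hTJ r hr]
        by_contra hpos
        have himg := (isPreconnected_iff_ordConnected.2 hJ).image h hhc
        obtain ⟨q, hq, hq0⟩ := himg.ordConnected.out (mem_image_of_mem h hs)
          (mem_image_of_mem h hr) ⟨hneg.le, (not_le.1 hpos).le⟩
        exact hne q hq hq0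
      have : ∫ r in T, deriv F r = ∫ r, deriv F r := by
        rw [← integral_indicator hT]
        congr 1
        ext r
        by_cases hr : r ∈ J
        · rw [indicator_of_mem (hall r hr)]
        · simp [indicator, hFJ r hr]
      rw [this]
      refine integral_eq_zero_of_hasDerivAt_of_integrable
        (fun x => (hF.differentiable one_ne_zero x).hasDerivAt) ?_ ?_
      · exact (hF.continuous_deriv le_rfl).integrable_of_hasCompactSupport hc.deriv
      · exact hF.continuous.integrable_of_hasCompactSupport hc
    · push Not at hex
      rw [← integral_indicator hT]
      refine integral_eq_zero_of_ae (ae_of_all _ fun r => ?_)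
      by_cases hr : r ∈ J
      · have : r ∉ T := by
          rw [hTJ r hr, not_le]
          exact lt_of_le_of_ne (hex r hr) (hne r hr).symm
        simp [this]
      · simp [indicator, hFJ r hr]

/-- Oblique coordinates `x = A y + s (n + A t)` adapted to a unit vector `n` preserve volume. -/
theorem exists_oblique_coordinates {n : Space3} (hn : ‖n‖ = 1) :
    ∃ A : EuclideanSpace ℝ (Fin 2) →ₗᵢ[ℝ] Space3, (∀ y, inner ℝ n (A y) = 0) ∧
      (∀ x, ∃ y, x = A y + (inner ℝ n x) • n) ∧
      ∀ t, MeasurePreserving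
        (fun q : EuclideanSpace ℝ (Fin 2) × ℝ => A q.1 + q.2 • (n + A t)) volume volume := by
  have : Fact (Module.finrank ℝ Space3 = 2 + 1) := ⟨by simp⟩
  have hn0 : n ≠ 0 := by rintro rfl; simp at hn
  have hfr : Module.finrank ℝ (ℝ ∙ n)ᗮ = 2 := Submodule.finrank_orthogonal_span_singleton hn0
  let b : OrthonormalBasis (Fin 2) ℝ (ℝ ∙ n)ᗮ :=
    (stdOrthonormalBasis ℝ (ℝ ∙ n)ᗮ).reindex (finCongr hfr)
  let A : EuclideanSpace ℝ (Fin 2) →ₗᵢ[ℝ] Space3 :=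
    (ℝ ∙ n)ᗮ.subtypeₗᵢ.comp b.repr.symm.toLinearIsometry
  have hA : ∀ y, inner ℝ n (A y) = 0 := fun y =>
    Submodule.mem_orthogonal_singleton_iff_inner_right.1 (b.repr.symm y).2
  refine ⟨A, hA, ?_, ?_⟩
  · intro x
    have hx : x - (inner ℝ n x) • n ∈ (ℝ ∙ n)ᗮ := by
      rw [Submodule.mem_orthogonal_singleton_iff_inner_right, inner_sub_right, inner_smul_right,
        real_inner_self_eq_norm_sq, hn]
      ring
    refine ⟨b.repr ⟨_, hx⟩, ?_⟩
    simp [A]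
  · intro t
    let lin : WithLp 2 (EuclideanSpace ℝ (Fin 2) × ℝ) →ₗ[ℝ] Space3 :=
      { toFun := fun q => A q.fst + q.snd • n
        map_add' := fun q q' => by simp only [WithLp.add_fst, WithLp.add_snd, map_add, add_smul]; abel
        map_smul' := fun c q => by
          simp only [WithLp.smul_fst, WithLp.smul_snd, map_smul, smul_add, smul_smul, smul_eq_mul,
            RingHom.id_apply] }
    let iso : WithLp 2 (EuclideanSpace ℝ (Fin 2) × ℝ) →ₗᵢ[ℝ] Space3 :=
      { lin with
        norm_map' := fun q => by
          have h0 : inner ℝ (A q.fst) (q.snd • n) = 0 := by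
            rw [inner_smul_right, real_inner_comm, hA, mul_zero]
          have := norm_add_sq_eq_norm_sq_add_norm_sq_real h0
          change ‖A q.fst + q.snd • n‖ = _
          rw [← sq_eq_sq₀ (norm_nonneg _) (norm_nonneg _), WithLp.prod_norm_sq_eq_of_L2, sq, this,
            A.norm_map, norm_smul, hn]
          ring }
    have hfr' : Module.finrank ℝ (WithLp 2 (EuclideanSpace ℝ (Fin 2) × ℝ))
        = Module.finrank ℝ Space3 := by
      rw [LinearEquiv.finrank_eq (WithLp.linearEquiv 2 ℝ (EuclideanSpace ℝ (Fin 2) × ℝ))]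
      simp
    have h1 : MeasurePreserving (fun q : EuclideanSpace ℝ (Fin 2) × ℝ => A q.1 + q.2 • n)
        volume volume :=
      (iso.toLinearIsometryEquiv hfr').measurePreserving.comp
        (WithLp.volume_preserving_toLp (EuclideanSpace ℝ (Fin 2)) ℝ)
    have h2 : MeasurePreserving (fun q : ℝ × EuclideanSpace ℝ (Fin 2) => (q.1, q.2 + q.1 • t))
        (volume.prod volume) (volume.prod volume) :=
      (MeasurePreserving.id volume).skew_product (g := fun s y => y + s • t)
        (by fun_prop) (ae_of_all _ fun s => map_add_right_eq_self _ _)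
    have h3 := h1.comp ((Measure.measurePreserving_swap.comp h2).comp
      (Measure.measurePreserving_swap (μ := (volume : Measure (EuclideanSpace ℝ (Fin 2))))
        (ν := (volume : Measure ℝ))))
    refine (congrArg (fun φ => MeasurePreserving φ volume volume) (funext fun q => ?_)).mp h3
    simp only [Function.comp_apply, Prod.swap, map_add, map_smul, smul_add]
    abel

theorem eq_zero_of_mem_frontier {K : Set Space3} (hK : IsClosed K) {h : Space3 → ℝ} {x : Space3}
    (hc : ContinuousAt h x) (hmem : ∀ᶠ y in 𝓝 x, (y ∈ K ↔ h y ≤ 0)) (hx : x ∈ frontier K) :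
    h x = 0 := by
  rw [hK.frontier_eq, mem_sdiff, mem_interior_iff_mem_nhds] at hx
  refine le_antisymm (hmem.self_of_nhds.1 hx.1) (not_lt.1 fun hlt => hx.2 ?_)
  filter_upwards [hmem, hc.eventually_lt_const hlt] with y hy hy0
  exact hy.2 hy0.le

theorem mem_frontier_of_eq_zero {K B : Set Space3} (hK : IsClosed K) (hB : IsOpen B)
    {h : Space3 → ℝ} (hmem : ∀ x ∈ B, (x ∈ K ↔ h x ≤ 0)) {w : Space3}
    (hinc : ∀ x ∈ B, ∀ s : ℝ, 0 < s → x + s • w ∈ B → h x < h (x + s • w)) {x : Space3}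
    (hx : x ∈ B) (h0 : h x = 0) : x ∈ frontier K := by
  rw [hK.frontier_eq, mem_sdiff, mem_interior_iff_mem_nhds]
  refine ⟨(hmem x hx).2 h0.le, fun hKx => ?_⟩
  have line : Filter.Tendsto (fun s : ℝ => x + s • w) (𝓝[>] 0) (𝓝 x) := by
    have : Continuous fun s : ℝ => x + s • w := by fun_prop
    simpa using (this.tendsto 0).mono_left nhdsWithin_le_nhds
  obtain ⟨s, h1, h2, hs⟩ := ((line.eventually (hB.mem_nhds hx)).and
    ((line.eventually hKx).and self_mem_nhdsWithin)).exists
  have h3 := hinc x hx s hs h1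
  have h4 := (hmem _ h1).1 h2
  linarith

theorem exists_area_distortion {ε : ℝ} (hε : 0 < ε) :
    ∃ c : NNReal, 1 < c ∧ ((c ^ 2 : NNReal) : ℝ) - 1 ≤ ε := by
  have h0 : 0 < min ε 1 := lt_min hε one_pos
  refine ⟨1 + (min ε 1 / 3).toNNReal, ?_, ?_⟩
  · simpa using h0
  · push_cast
    rw [Real.coe_toNNReal _ (by positivity)]
    nlinarith [min_le_left ε 1, min_le_right ε 1]

/-- Near a regular boundary point with normal `n`, the integral of a derivative along an oblique
direction `w`, `⟪n, w⟫ = 1`, is the boundary integral up to a small error. -/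
theorem exists_oblique_flux_approx {K : Set Space3} (hK : IsClosed K)
    {p n : Space3} (hn : ‖n‖ = 1) {h : Space3 → ℝ}
    (hd : HasStrictFDerivAt h (innerSL ℝ n) p)
    (hmem : ∀ᶠ x in 𝓝 p, (x ∈ K ↔ h x ≤ 0)) {w : Space3} (hw : inner ℝ n w = 1)
    {ε : ℝ} (hε : 0 < ε) :
    ∃ U, IsOpen U ∧ p ∈ U ∧ ∀ f : Space3 → ℝ, ContDiff ℝ 1 f → HasCompactSupport f →
      tsupport f ⊆ U →
      |(∫ x in K, fderiv ℝ f x w) - ∫ x in frontier K, f x ∂μHE[2]|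
        ≤ ε * ∫ x in frontier K, |f x| ∂μHE[2] := by
  obtain ⟨c, hc1, hcε⟩ := exists_area_distortion hε
  have hc1' : (1 : ℝ) < c := by exact_mod_cast hc1
  have hw0 : w ≠ 0 := by rintro rfl; simp at hw
  have hwpos : 0 < ‖w‖ := norm_pos_iff.2 hw0
  set θ : ℝ := 1 - (c : ℝ)⁻¹ with hθ
  have hcinv : (c : ℝ)⁻¹ < 1 := inv_lt_one_of_one_lt₀ hc1'
  have hcc : (c : ℝ) * (c : ℝ)⁻¹ = 1 := mul_inv_cancel₀ (by positivity)
  have hcinv0 : 0 < (c : ℝ)⁻¹ := by positivity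
  have hθ0 : 0 < θ := by linarith
  have hθ1 : 1 + θ ≤ c := by nlinarith
  set η : ℝ := θ / ‖w‖ with hη
  have hη0 : 0 < η := by positivity
  have hηw : η * ‖w‖ = θ := div_mul_cancel₀ _ hwpos.ne'
  obtain ⟨N, hN, hlin⟩ := hd.approximates_deriv_on_nhds (c := η.toNNReal) (Or.inr (by simpa))
  obtain ⟨r, hr0, hr⟩ := Metric.mem_nhds_iff.1 (Filter.inter_mem hN hmem)
  set B := Metric.ball p r with hBdef
  have hBo : IsOpen B := Metric.isOpen_ball
  have lin : ∀ x ∈ B, ∀ x' ∈ B, |h x - h x' - inner ℝ n (x - x')| ≤ η * ‖x - x'‖ := by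
    intro x hx x' hx'
    simpa [hη0.le] using hlin x (hr hx).1 x' (hr hx').1
  have hmemB : ∀ x ∈ B, (x ∈ K ↔ h x ≤ 0) := fun x hx => (hr hx).2
  have hcB : ContinuousOn h B := hlin.continuousOn.mono fun x hx => (hr hx).1
  have hinc : ∀ x ∈ B, ∀ s : ℝ, 0 < s → x + s • w ∈ B → h x < h (x + s • w) := by
    intro x hx s hs hxs
    have := (abs_le.1 (lin _ hxs x hx)).1
    rw [add_sub_cancel_left, inner_smul_right, hw, norm_smul, Real.norm_of_nonneg hs.le] at this
    have : η * (s * ‖w‖) = s * θ := by rw [← hηw]; ring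
    nlinarith
  have hfr : ∀ x ∈ B, (x ∈ frontier K ↔ h x = 0) := fun x hx =>
    ⟨eq_zero_of_mem_frontier hK (hcB.continuousAt (hBo.mem_nhds hx))
      (Filter.eventually_of_mem (hBo.mem_nhds hx) hmemB),
      mem_frontier_of_eq_zero hK hBo hmemB hinc hx⟩
  obtain ⟨A, hA, hsurj, hpres⟩ := exists_oblique_coordinates hn
  obtain ⟨t, ht⟩ : ∃ t, w = n + A t := by
    obtain ⟨y, hy⟩ := hsurj w
    exact ⟨y, by rw [hw, one_smul] at hy; rw [hy, add_comm]⟩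
  let Y : Space3 →L[ℝ] EuclideanSpace ℝ (Fin 2) :=
    (ContinuousLinearMap.adjoint A.toContinuousLinearMap).comp
      (ContinuousLinearMap.id ℝ Space3 - (innerSL ℝ n).smulRight w)
  have hadj : ∀ y, ContinuousLinearMap.adjoint A.toContinuousLinearMap (A y) = y := by
    intro y
    refine ext_inner_right ℝ fun z => ?_
    rw [ContinuousLinearMap.adjoint_inner_left]
    exact A.inner_map_map y z
  have hYdec : ∀ x, x = A (Y x) + (inner ℝ n x : ℝ) • w := by
    intro x
    obtain ⟨y, hy⟩ := hsurj (x - (inner ℝ n x : ℝ) • w)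
    have h0 : (inner ℝ n (x - (inner ℝ n x : ℝ) • w) : ℝ) = 0 := by
      rw [inner_sub_right, inner_smul_right, hw]; ring
    rw [h0, zero_smul, add_zero] at hy
    have : Y x = y := by
      change ContinuousLinearMap.adjoint A.toContinuousLinearMap (x - (inner ℝ n x : ℝ) • w) = y
      rw [hy, hadj]
    rw [this, ← hy]
    abel
  have hYcoord : ∀ y (s : ℝ), Y (A y + s • w) = y := by
    intro y s
    have h0 : (inner ℝ n (A y + s • w) : ℝ) = s := by
      rw [inner_add_right, hA, inner_smul_right, hw]; ring
    change ContinuousLinearMap.adjoint A.toContinuousLinearMap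
      (A y + s • w - (inner ℝ n (A y + s • w) : ℝ) • w) = y
    rw [h0, add_sub_cancel_right, hadj]
  set M := frontier K ∩ B with hM
  have hMm : MeasurableSet M := isClosed_frontier.measurableSet.inter hBo.measurableSet
  have bil : ∀ x ∈ M, ∀ x' ∈ M, |‖Y (x - x')‖ - ‖x - x'‖| ≤ θ * ‖x - x'‖ := by
    intro x hx x' hx'
    have h1 := lin x hx.2 x' hx'.2
    rw [(hfr x hx.2).1 hx.1, (hfr x' hx'.2).1 hx'.1, sub_zero, zero_sub, abs_neg] at h1
    have h2 := hYdec (x - x')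
    have h3 : ‖Y (x - x')‖ = ‖A (Y (x - x'))‖ := (A.norm_map _).symm
    have h4 : A (Y (x - x')) - (x - x') = -((inner ℝ n (x - x') : ℝ) • w) := by
      rw [eq_neg_iff_add_eq_zero]
      nth_rw 2 [h2]
      abel
    rw [h3]
    refine (abs_norm_sub_norm_le _ _).trans ?_
    rw [h4, norm_neg, norm_smul, Real.norm_eq_abs]
    calc _ ≤ η * ‖x - x'‖ * ‖w‖ := by gcongr
      _ = _ := by rw [← hηw]; ring
  let Yp : Space3 → EuclideanSpace ℝ (Fin 2) := fun x => Y (x - p)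
  have hYpc : Continuous Yp := by fun_prop
  have hYpd : ∀ x x', dist (Yp x) (Yp x') = ‖Y (x - x')‖ := fun x x' => by
    rw [dist_eq_norm, ← map_sub, sub_sub_sub_cancel_right]
  have hlip : LipschitzOnWith c Yp M := by
    refine LipschitzOnWith.of_dist_le_mul fun x hx x' hx' => ?_
    rw [hYpd, dist_eq_norm]
    have := (abs_le.1 (bil x hx x' hx')).2
    nlinarith [norm_nonneg (x - x')]
  have hanti : ∀ x ∈ M, ∀ x' ∈ M, dist x x' ≤ c * dist (Yp x) (Yp x') := by
    intro x hx x' hx'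
    rw [hYpd, dist_eq_norm]
    have h1 := (abs_le.1 (bil x hx x' hx')).1
    have h2 : (c : ℝ)⁻¹ * ‖x - x'‖ ≤ ‖Y (x - x')‖ := by rw [hθ] at h1; linarith
    calc ‖x - x'‖ = c * ((c : ℝ)⁻¹ * ‖x - x'‖) := by rw [← mul_assoc, hcc, one_mul]
      _ ≤ _ := by gcongr
  obtain ⟨cmp1, cmp2⟩ := area_compare hMm hYpc hlip hanti
  refine ⟨B, hBo, Metric.mem_ball_self hr0, fun f hf hfc hfB => ?_⟩
  have hf0 : ∀ x ∉ B, f x = 0 := fun x hx => image_eq_zero_of_notMem_tsupport fun h => hx (hfB h)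
  have hf0' : ∀ x ∉ B, fderiv ℝ f x = 0 := fun x hx =>
    image_eq_zero_of_notMem_tsupport fun h => hx (hfB (tsupport_fderiv_subset ℝ h))
  set k : Space3 → ℝ := K.indicator fun x => fderiv ℝ f x w with hk
  have hki : Integrable k := by
    refine Integrable.indicator ?_ hK.measurableSet
    exact ((hf.continuous_fderiv one_ne_zero).clm_apply continuous_const).integrable_of_hasCompactSupport
      (hfc.fderiv_apply ℝ w)
  let Ψ : EuclideanSpace ℝ (Fin 2) × ℝ → Space3 := fun q => p + (A q.1 + q.2 • w)
  have hΨ : MeasurePreserving Ψ volume volume := by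
    have := (measurePreserving_add_left volume p).comp (hpres t)
    rw [← ht] at this
    exact this
  have hΨc : Continuous Ψ := by fun_prop
  have hΨe : MeasurableEmbedding Ψ := by
    refine hΨc.measurableEmbedding fun q q' hq => ?_
    have h1 : A q.1 + q.2 • w = A q'.1 + q'.2 • w := add_left_cancel hq
    have h2 : q.1 = q'.1 := by rw [← hYcoord q.1 q.2, h1, hYcoord]
    rw [h2] at h1
    exact Prod.ext h2 (smul_left_injective ℝ hw0 (add_left_cancel h1))
  have hkΨ : Integrable (fun q => k (Ψ q)) (volume.prod volume) :=
    (hΨ.integrable_comp_emb hΨe).2 hki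
  set G : EuclideanSpace ℝ (Fin 2) → ℝ := fun y => ∫ s, k (Ψ (y, s)) with hG
  have hGi : Integrable G := hkΨ.integral_prod_left
  have hGint : ∫ x in K, fderiv ℝ f x w = ∫ y, G y := by
    rw [← integral_indicator hK.measurableSet, ← hΨ.integral_comp hΨe k]
    exact integral_prod _ hkΨ
  have line : ∀ y,
      (∀ s, Ψ (y, s) ∈ B → h (Ψ (y, s)) = 0 → G y = f (Ψ (y, s))) ∧
        ((∀ s, Ψ (y, s) ∈ B → h (Ψ (y, s)) ≠ 0) → G y = 0) := by
    intro y
    have hline : Continuous fun s : ℝ => Ψ (y, s) := by fun_prop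
    have hemb : IsClosedEmbedding fun s : ℝ => Ψ (y, s) := by
      have h1 : IsClosedEmbedding fun s : ℝ => s • w := isClosedEmbedding_smul_left hw0
      have h2 := (Homeomorph.addLeft (p + A y)).isClosedEmbedding.comp h1
      convert h2 using 2 with s
      simp only [Ψ, Function.comp_apply, Homeomorph.coe_addLeft]
      abel
    have hder : ∀ s, deriv (fun s => f (Ψ (y, s))) s = fderiv ℝ f (Ψ (y, s)) w := by
      intro s
      have h1 : HasDerivAt (fun s : ℝ => Ψ (y, s)) w s := by
        simpa only [id_eq, one_smul] using
          (((hasDerivAt_id s).smul_const w).const_add (A y)).const_add p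
      exact ((hf.differentiable one_ne_zero _).hasFDerivAt.comp_hasDerivAt s h1).deriv
    have hGy : G y = ∫ s in {s | Ψ (y, s) ∈ K}, deriv (fun s => f (Ψ (y, s))) s := by
      rw [← integral_indicator (show MeasurableSet {s | Ψ (y, s) ∈ K} from
        hline.measurable hK.measurableSet)]
      refine integral_congr_ae (ae_of_all _ fun s => ?_)
      simp only [k, indicator, hder]
      rfl
    have hconv : Convex ℝ {s : ℝ | Ψ (y, s) ∈ B} := by
      intro a ha b hb μ ν hμ hν hμν
      have h1 := convex_ball p r ha hb hμ hν hμν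
      have h2 : μ • Ψ (y, a) + ν • Ψ (y, b) = Ψ (y, μ • a + ν • b) := by
        have e : ν = 1 - μ := by linarith
        subst e
        simp only [Ψ, smul_eq_mul]
        module
      rwa [h2] at h1
    have key := setIntegral_deriv_of_strictMonoOn (F := fun s => f (Ψ (y, s)))
      (h := fun s => h (Ψ (y, s))) (J := {s | Ψ (y, s) ∈ B}) (T := {s | Ψ (y, s) ∈ K})
      (hf.comp (by fun_prop)) (hfc.comp_isClosedEmbedding hemb) hconv.ordConnected
      (fun s hs => by rw [hder, hf0' _ hs]; rfl)
      (fun a ha b hb hab => by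
        have e : Ψ (y, b) = Ψ (y, a) + (b - a) • w := by simp only [Ψ]; module
        have := hinc _ ha (b - a) (sub_pos.2 hab) (by rw [← e]; exact hb)
        rwa [← e] at this)
      (hcB.comp hline.continuousOn fun s hs => hs)
      (hline.measurable hK.measurableSet)
      (fun s hs => hmemB _ hs)
    rw [hGy]
    exact ⟨fun s hs h0 => key.1 s hs h0, fun hne => key.2 hne⟩
  have hGM : ∀ x ∈ M, G (Yp x) = f x := by
    intro x hx
    have e : Ψ (Yp x, inner ℝ n (x - p)) = x := by
      simp only [Ψ, Yp]
      rw [← hYdec]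
      abel
    have := (line (Yp x)).1 (inner ℝ n (x - p)) (by rw [e]; exact hx.2)
      (by rw [e]; exact (hfr x hx.2).1 hx.1)
    rwa [e] at this
  have hG0 : ∀ y ∉ Yp '' M, G y = 0 := by
    intro y hy
    refine (line y).2 fun s hs h0 => hy ⟨Ψ (y, s), ⟨(hfr _ hs).2 h0, hs⟩, ?_⟩
    simp only [Yp, Ψ, add_sub_cancel_left, hYcoord]
  have hGm : Integrable G ((μHE[2].restrict M).map Yp) :=
    ((hGi.restrict (s := Yp '' M)).smul_measure_nnreal (c := c ^ 2)).mono_measure cmp2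
  have e1 : ∫ y, G y = ∫ y in Yp '' M, G y :=
    (setIntegral_eq_integral_of_forall_compl_eq_zero hG0).symm
  have toM : ∀ g : Space3 → ℝ, (∀ x ∉ B, g x = 0) →
      ∫ x in frontier K, g x ∂μHE[2] = ∫ x in M, g x ∂μHE[2] := by
    intro g hg
    exact setIntegral_eq_of_subset_of_forall_sdiff_eq_zero isClosed_frontier.measurableSet
      inter_subset_left fun x hx => hg x fun hxB => hx.2 ⟨hx.1, hxB⟩
  have e2 : ∫ x in frontier K, f x ∂μHE[2] = ∫ y, G y ∂((μHE[2].restrict M).map Yp) := by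
    rw [toM f hf0, integral_map hYpc.aemeasurable hGm.1]
    exact setIntegral_congr_fun hMm fun x hx => (hGM x hx).symm
  have e3 : ∫ x in frontier K, |f x| ∂μHE[2] = ∫ y, |G y| ∂((μHE[2].restrict M).map Yp) := by
    rw [toM (fun x => |f x|) (fun x hx => by simp [hf0 x hx]),
      integral_map hYpc.aemeasurable hGm.abs.1]
    exact setIntegral_congr_fun hMm fun x hx => by simp only [hGM x hx]
  rw [hGint, e1, e2, e3]
  refine (abs_integral_sub_integral_le cmp1 cmp2 hGi.restrict hGm
    (one_le_pow₀ hc1.le)).trans ?_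
  exact mul_le_mul_of_nonneg_right hcε (integral_nonneg fun y => abs_nonneg _)

/-- Near `p` the integral over `K` of the derivative of `f` in the direction `w` is, up to a small
relative error, `a` times the integral of `f` over the boundary. -/
def FluxApprox (K : Set Space3) (p w : Space3) (a : ℝ) : Prop :=
  ∀ ε : ℝ, 0 < ε → ∃ U, IsOpen U ∧ p ∈ U ∧ ∀ f : Space3 → ℝ, ContDiff ℝ 1 f → HasCompactSupport f →
    tsupport f ⊆ U →
    |(∫ x in K, fderiv ℝ f x w) - a * ∫ x in frontier K, f x ∂μHE[2]|
      ≤ ε * ∫ x in frontier K, |f x| ∂μHE[2]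

theorem integrable_fderiv_apply {f : Space3 → ℝ} (hf : ContDiff ℝ 1 f) (hc : HasCompactSupport f)
    (w : Space3) : Integrable fun x => fderiv ℝ f x w :=
  ((hf.continuous_fderiv one_ne_zero).clm_apply continuous_const).integrable_of_hasCompactSupport
    (hc.fderiv_apply ℝ w)

theorem FluxApprox.add {K : Set Space3} {p w w' : Space3} {a a' : ℝ} (h : FluxApprox K p w a)
    (h' : FluxApprox K p w' a') : FluxApprox K p (w + w') (a + a') := by
  intro ε hε
  obtain ⟨U, hU, hpU, H⟩ := h (ε / 2) (by linarith)
  obtain ⟨U', hU', hpU', H'⟩ := h' (ε / 2) (by linarith)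
  refine ⟨U ∩ U', hU.inter hU', ⟨hpU, hpU'⟩, fun f hf hfc hfU => ?_⟩
  have h1 := H f hf hfc (hfU.trans inter_subset_left)
  have h2 := H' f hf hfc (hfU.trans inter_subset_right)
  simp only [map_add]
  rw [integral_add (integrable_fderiv_apply hf hfc w).restrict
    (integrable_fderiv_apply hf hfc w').restrict]
  calc _ = |((∫ x in K, fderiv ℝ f x w) - a * ∫ x in frontier K, f x ∂μHE[2]) +
        ((∫ x in K, fderiv ℝ f x w') - a' * ∫ x in frontier K, f x ∂μHE[2])| := by
        congr 1; ring
    _ ≤ _ := abs_add_le _ _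
    _ ≤ _ := by linarith

theorem FluxApprox.smul {K : Set Space3} {p w : Space3} {a : ℝ} (h : FluxApprox K p w a) (c : ℝ) :
    FluxApprox K p (c • w) (c * a) := by
  intro ε hε
  obtain ⟨U, hU, hpU, H⟩ := h (ε / (|c| + 1)) (by positivity)
  refine ⟨U, hU, hpU, fun f hf hfc hfU => ?_⟩
  have h1 := H f hf hfc hfU
  have h0 : 0 ≤ ∫ x in frontier K, |f x| ∂μHE[2] := integral_nonneg fun _ => abs_nonneg _
  simp only [map_smul, smul_eq_mul]
  rw [integral_const_mul, mul_assoc, ← mul_sub, abs_mul]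
  calc _ ≤ |c| * (ε / (|c| + 1) * ∫ x in frontier K, |f x| ∂μHE[2]) := by gcongr
    _ = (|c| / (|c| + 1)) * (ε * ∫ x in frontier K, |f x| ∂μHE[2]) := by ring
    _ ≤ _ := mul_le_of_le_one_left (by positivity)
      ((div_le_one (by positivity)).2 (by linarith))

namespace IsLocalDefiningFunction

variable {K : Set Space3} {p : Space3} {g : Space3 → ℝ}

theorem fluxApprox (hK : IsClosed K) (hg : IsLocalDefiningFunction K p g) (w : Space3) :
    FluxApprox K p w (inner ℝ (‖gradient g p‖⁻¹ • gradient g p) w) := by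
  set n := ‖gradient g p‖⁻¹ • gradient g p with hn
  have hpos : 0 < ‖gradient g p‖ := norm_pos_iff.2 hg.gradient_ne_zero
  have hn1 : ‖n‖ = 1 := by simp [hn, norm_smul, hpos.ne']
  have hstrict : HasStrictFDerivAt (fun x => ‖gradient g p‖⁻¹ • g x) (innerSL ℝ n) p := by
    have h1 := (hg.contDiffAt.hasStrictFDerivAt one_ne_zero).fun_const_smul ‖gradient g p‖⁻¹
    have h2 : fderiv ℝ g p = innerSL ℝ (gradient g p) := by
      have := (hg.contDiffAt.differentiableAt one_ne_zero).hasGradientAt.hasFDerivAt.fderiv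
      rw [this]; rfl
    rwa [h2, ← map_smul, ← hn] at h1
  have hmem : ∀ᶠ x in 𝓝 p, (x ∈ K ↔ ‖gradient g p‖⁻¹ • g x ≤ 0) := by
    filter_upwards [hg.mem_iff] with x hx
    rw [hx, smul_eq_mul, ← div_eq_inv_mul, div_le_iff₀ hpos, zero_mul]
  have base : ∀ v, inner ℝ n v = 1 → FluxApprox K p v 1 := by
    intro v hv ε hε
    simpa only [one_mul] using exists_oblique_flux_approx hK hn1 hstrict hmem hv hε
  have hnn : inner ℝ n n = 1 := by rw [real_inner_self_eq_norm_sq, hn1, one_pow]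
  have h1 := ((base n hnn).smul (inner ℝ n w - 1)).add
    (base (w - (inner ℝ n w - 1 : ℝ) • n) (by
      rw [inner_sub_right, inner_smul_right, hnn]; ring))
  simpa using h1

theorem eventually (hK : IsClosed K) (hg : IsLocalDefiningFunction K p g) :
    ∀ᶠ x in 𝓝 p, x ∈ frontier K → IsLocalDefiningFunction K x g := by
  have hgc : ContinuousAt (gradient g) p :=
    (InnerProductSpace.toDual ℝ Space3).symm.continuous.continuousAt.comp
      (hg.contDiffAt.continuousAt_fderiv one_ne_zero)
  filter_upwards [hg.contDiffAt.eventually (by simp), hg.mem_iff.eventually_nhds,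
    hgc.eventually_ne hg.gradient_ne_zero] with x h1 h2 h3 hx
  exact ⟨h1, eq_zero_of_mem_frontier hK h1.continuousAt h2 hx, h3, h2⟩

theorem outwardUnitNormal_eq (hg : IsLocalDefiningFunction K p g) :
    outwardUnitNormal K p = ‖gradient g p‖⁻¹ • gradient g p :=
  _root_.outwardUnitNormal_eq ⟨g, hg, rfl⟩

theorem continuousWithinAt_normal (hK : IsClosed K) (hg : IsLocalDefiningFunction K p g) :
    ContinuousWithinAt (outwardUnitNormal K) (frontier K) p := by
  have hgc : ContinuousAt (gradient g) p :=
    (InnerProductSpace.toDual ℝ Space3).symm.continuous.continuousAt.comp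
      (hg.contDiffAt.continuousAt_fderiv one_ne_zero)
  have h1 : ContinuousAt (fun x => ‖gradient g x‖⁻¹ • gradient g x) p :=
    (hgc.norm.inv₀ (norm_ne_zero_iff.2 hg.gradient_ne_zero)).smul hgc
  refine h1.continuousWithinAt.congr_of_eventuallyEq ?_ hg.outwardUnitNormal_eq
  filter_upwards [nhdsWithin_le_nhds (hg.eventually hK), self_mem_nhdsWithin] with x hx hxf
  exact (hx hxf).outwardUnitNormal_eq

end IsLocalDefiningFunction

theorem isClosed_frontier_diff_regularBoundary {K : Set Space3} (hK : IsClosed K) :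
    IsClosed (frontier K \ regularBoundary K) := by
  rw [← isOpen_compl_iff, isOpen_iff_mem_nhds]
  intro x hx
  by_cases hf : x ∈ frontier K
  · obtain ⟨g, hg⟩ : x ∈ regularBoundary K := by_contra fun h => hx ⟨hf, h⟩
    filter_upwards [hg.eventually hK] with y hy hy'
    exact hy'.2 ⟨g, hy hy'.1⟩
  · filter_upwards [isClosed_frontier.isOpen_compl.mem_nhds hf] with y hy hy'
    exact hy hy'.1

theorem norm_outwardUnitNormal_le (K : Set Space3) (p : Space3) : ‖outwardUnitNormal K p‖ ≤ 1 := by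
  unfold outwardUnitNormal
  split_ifs with h
  · obtain ⟨g, hg, he⟩ := h.choose_spec
    rw [he]
    simp [norm_smul, hg.gradient_ne_zero]
  · simp

theorem aestronglyMeasurable_outwardUnitNormal {K : Set Space3} (hK : IsClosed K)
    (hb : HasPiecewiseC1Boundary K) :
    AEStronglyMeasurable (outwardUnitNormal K) (μHE[2].restrict (frontier K)) := by
  have hE := isClosed_frontier_diff_regularBoundary hK
  have hR : (frontier K ∩ regularBoundary K : Set Space3) =ᵐ[μHE[2]] frontier K := by
    refine inter_subset_left.eventuallyLE.antisymm (ae_le_set.2 ?_)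
    rw [sdiff_self_inter]
    exact hb.area_singular
  have hRm : MeasurableSet (frontier K ∩ regularBoundary K) := by
    rw [← Set.sdiff_sdiff_right_self]
    exact isClosed_frontier.measurableSet.diff hE.measurableSet
  rw [← Measure.restrict_congr_set hR]
  refine ContinuousOn.aestronglyMeasurable (fun x hx => ?_) hRm
  obtain ⟨g, hg⟩ := hx.2
  exact (hg.continuousWithinAt_normal hK).mono inter_subset_left

theorem integrableOn_inner_outwardUnitNormal {K : Set Space3} (hK : IsCompact K)
    (hb : HasPiecewiseC1Boundary K) {v : Space3 → Space3} (hv : ContinuousOn v (frontier K)) :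
    IntegrableOn (fun x => inner ℝ (v x) (outwardUnitNormal K x)) (frontier K) μHE[2] := by
  have hfc : IsCompact (frontier K) := hK.of_isClosed_subset isClosed_frontier
    hK.isClosed.frontier_subset
  obtain ⟨C, hC⟩ := hfc.exists_bound_of_continuousOn hv
  refine IntegrableOn.of_bound hb.area_lt_top
    ((hv.aestronglyMeasurable hfc.measurableSet).inner
      (aestronglyMeasurable_outwardUnitNormal hK.isClosed hb)) C ?_
  refine (ae_restrict_iff' hfc.measurableSet).2 (ae_of_all _ fun x hx => ?_)
  calc _ ≤ ‖v x‖ * ‖outwardUnitNormal K x‖ := norm_inner_le_norm _ _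
    _ ≤ C * 1 := mul_le_mul (hC x hx) (norm_outwardUnitNormal_le K x) (norm_nonneg _)
      ((norm_nonneg _).trans (hC x hx))
    _ = C := mul_one C

theorem integral_fderiv_apply_eq_zero {f : Space3 → ℝ} (hf : ContDiff ℝ 1 f)
    (hc : HasCompactSupport f) (w : Space3) : ∫ x, fderiv ℝ f x w = 0 := by
  have h := integral_mul_fderiv_eq_neg_fderiv_mul_of_integrable (𝕜 := ℝ) (μ := volume)
    (f := fun _ : Space3 => (1 : ℝ)) (g := f) (v := w) (by simp)
    (by simpa using integrable_fderiv_apply hf hc w)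
    (by simpa using hf.continuous.integrable_of_hasCompactSupport hc)
    (fun _ _ => differentiableAt_const _) (fun x _ => hf.differentiable one_ne_zero x)
  simpa using h

/-- The local form of the divergence theorem at a point that is not a singular boundary point. -/
theorem exists_flux_approx {K : Set Space3} (hK : IsCompact K) (hb : HasPiecewiseC1Boundary K)
    (w : Space3) {p : Space3} (hp : p ∉ frontier K \ regularBoundary K) {ε : ℝ} (hε : 0 < ε) :
    ∃ U, IsOpen U ∧ p ∈ U ∧ ∀ f : Space3 → ℝ, ContDiff ℝ 1 f → HasCompactSupport f →
      tsupport f ⊆ U →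
      |(∫ x in K, fderiv ℝ f x w) -
          ∫ x in frontier K, inner ℝ (f x • w) (outwardUnitNormal K x) ∂μHE[2]|
        ≤ ε * ∫ x in frontier K, |f x| ∂μHE[2] := by
  have off : ∀ f : Space3 → ℝ, (∀ x ∈ frontier K, f x = 0) → (∫ x in K, fderiv ℝ f x w = 0) →
      |(∫ x in K, fderiv ℝ f x w) -
          ∫ x in frontier K, inner ℝ (f x • w) (outwardUnitNormal K x) ∂μHE[2]|
        ≤ ε * ∫ x in frontier K, |f x| ∂μHE[2] := by
    intro f h0 h1
    have h2 : ∫ x in frontier K, inner ℝ (f x • w) (outwardUnitNormal K x) ∂μHE[2] = 0 :=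
      setIntegral_eq_zero_of_forall_eq_zero fun x hx => by simp [h0 x hx]
    rw [h1, h2, sub_zero, abs_zero]
    exact mul_nonneg hε.le (integral_nonneg fun _ => abs_nonneg _)
  by_cases hpK : p ∈ K
  · by_cases hpf : p ∈ frontier K
    · obtain ⟨g, hg⟩ : p ∈ regularBoundary K := by_contra fun h => hp ⟨hpf, h⟩
      obtain ⟨U, hU, hpU, H⟩ := hg.fluxApprox hK.isClosed w (ε / 2) (by linarith)
      rw [← hg.outwardUnitNormal_eq] at H
      have hcont : ContinuousWithinAt (fun x => inner ℝ w (outwardUnitNormal K x))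
          (frontier K) p :=
        continuousWithinAt_const.inner (hg.continuousWithinAt_normal hK.isClosed)
      obtain ⟨V, hV, hpV, hVb⟩ : ∃ V, IsOpen V ∧ p ∈ V ∧ ∀ x ∈ V ∩ frontier K,
          |inner ℝ w (outwardUnitNormal K x) - inner ℝ w (outwardUnitNormal K p)| ≤ ε / 2 := by
        have := hcont (Metric.closedBall_mem_nhds _ (show 0 < ε / 2 by linarith))
        obtain ⟨V, hV, hpV, hVs⟩ := mem_nhdsWithin.1 this
        exact ⟨V, hV, hpV, fun x hx => hVs hx⟩
      refine ⟨U ∩ V, hU.inter hV, ⟨hpU, hpV⟩, fun f hf hfc hfU => ?_⟩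
      have h1 := H f hf hfc (hfU.trans inter_subset_left)
      have hfin : IsFiniteMeasure (μHE[2].restrict (frontier K)) :=
        isFiniteMeasure_restrict.2 hb.area_lt_top.ne
      have hfi : IntegrableOn f (frontier K) μHE[2] := by
        obtain ⟨C, hC⟩ := hfc.exists_bound_of_continuous hf.continuous
        exact Integrable.of_bound hf.continuous.aestronglyMeasurable C (ae_of_all _ hC)
      have hni : IntegrableOn (fun x => inner ℝ (f x • w) (outwardUnitNormal K x))
          (frontier K) μHE[2] :=
        integrableOn_inner_outwardUnitNormal hK hb
          (hf.continuous.smul continuous_const).continuousOn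
      have h2 : |(inner ℝ (outwardUnitNormal K p) w * ∫ x in frontier K, f x ∂μHE[2]) -
          ∫ x in frontier K, inner ℝ (f x • w) (outwardUnitNormal K x) ∂μHE[2]| ≤
          ε / 2 * ∫ x in frontier K, |f x| ∂μHE[2] := by
        rw [← integral_const_mul, ← integral_const_mul, ← integral_sub (hfi.const_mul _) hni,
          ← Real.norm_eq_abs]
        refine norm_integral_le_of_norm_le (hfi.abs.const_mul _) ?_
        refine (ae_restrict_iff' isClosed_frontier.measurableSet).2 (ae_of_all _ fun x hx => ?_)
        by_cases hxV : x ∈ V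
        · rw [real_inner_smul_left, real_inner_comm, mul_comm, ← mul_sub, norm_mul, mul_comm,
            Real.norm_eq_abs, Real.norm_eq_abs, abs_sub_comm]
          exact mul_le_mul_of_nonneg_right (hVb x ⟨hxV, hx⟩) (abs_nonneg _)
        · have : f x = 0 := image_eq_zero_of_notMem_tsupport fun h => hxV (hfU h).2
          simp [this]
      rw [abs_le] at h1 h2 ⊢
      constructor <;> linarith [h1.1, h1.2, h2.1, h2.2]
    · have hpi : p ∈ interior K := by
        rw [hK.isClosed.frontier_eq] at hpf
        exact by_contra fun h => hpf ⟨hpK, h⟩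
      refine ⟨interior K, isOpen_interior, hpi, fun f hf hfc hfU => off f (fun x hx => ?_) ?_⟩
      · refine image_eq_zero_of_notMem_tsupport fun h => ?_
        rw [hK.isClosed.frontier_eq] at hx
        exact hx.2 (hfU h)
      · rw [setIntegral_eq_integral_of_forall_compl_eq_zero, integral_fderiv_apply_eq_zero hf hfc]
        intro x hx
        rw [image_eq_zero_of_notMem_tsupport (f := fderiv ℝ f) fun h =>
          hx (interior_subset (hfU (tsupport_fderiv_subset ℝ h)))]
        rfl
  · refine ⟨Kᶜ, hK.isClosed.isOpen_compl, hpK, fun f hf hfc hfU => off f (fun x hx => ?_) ?_⟩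
    · exact image_eq_zero_of_notMem_tsupport fun h => hfU h (hK.isClosed.frontier_subset hx)
    · refine setIntegral_eq_zero_of_forall_eq_zero fun x hx => ?_
      rw [image_eq_zero_of_notMem_tsupport (f := fderiv ℝ f) fun h =>
        hfU (tsupport_fderiv_subset ℝ h) hx]
      rfl

theorem exists_finite_ball_cover {E : Set Space3} (hE : IsCompact E) (h0 : μHE[2] E = 0) {ε : ℝ}
    (hε : 0 < ε) : ∃ (t : Finset ℕ) (x : ℕ → Space3) (r : ℕ → ℝ),
      (∀ i ∈ t, x i ∈ E ∧ 0 < r i ∧ r i < ε) ∧ (E ⊆ ⋃ i ∈ t, Metric.ball (x i) (r i)) ∧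
      ∑ i ∈ t, r i ^ 2 ≤ ε := by
  rw [area_eq_zero_iff, Measure.hausdorffMeasure_apply] at h0
  have h1 := (iSup₂_le_iff.1 h0.le) (ENNReal.ofReal (ε / 2)) (by simpa using hε)
  have h2 := lt_of_le_of_lt h1 (show (0 : ENNReal) < ENNReal.ofReal (ε / 4) by simpa using hε)
  simp only [iInf_lt_iff] at h2
  obtain ⟨T, hcov, hdiam, hsum⟩ := h2
  obtain ⟨e, he, c, hec, hcε⟩ := posSumOfEncodable (lt_min (by linarith : 0 < ε / 4) one_pos) ℕ
  have hele : ∀ i, e i ≤ c := fun i => le_hasSum hec i fun j _ => (he j).le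
  have hdiam' : ∀ i, Metric.diam (T i) ≤ ε / 2 := fun i => by
    have := ENNReal.toReal_mono ENNReal.ofReal_ne_top (hdiam i)
    rwa [ENNReal.toReal_ofReal (by linarith)] at this
  have hbdd : ∀ i, Bornology.IsBounded (T i) := fun i =>
    Metric.isBounded_iff_ediam_ne_top.2 ((hdiam i).trans_lt ENNReal.ofReal_lt_top).ne
  classical
  let x : ℕ → Space3 := fun i => if h : (T i ∩ E).Nonempty then h.choose else 0
  have hx : ∀ i, (T i ∩ E).Nonempty → x i ∈ T i ∩ E := fun i h => by
    simp only [x, dif_pos h]; exact h.choose_spec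
  have cover : E ⊆ ⋃ i ∈ {i | (T i ∩ E).Nonempty},
      Metric.ball (x i) (Metric.diam (T i) + e i) := by
    intro y hy
    obtain ⟨i, hi⟩ := mem_iUnion.1 (hcov hy)
    have hne : (T i ∩ E).Nonempty := ⟨y, hi, hy⟩
    refine mem_biUnion (show i ∈ {i | (T i ∩ E).Nonempty} from hne) ?_
    have := Metric.dist_le_diam_of_mem (hbdd i) hi (hx i hne).1
    rw [Metric.mem_ball]
    linarith [he i]
  obtain ⟨b, hb, hbf, hbc⟩ := hE.elim_finite_subcover_image (fun i _ => Metric.isOpen_ball) cover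
  refine ⟨hbf.toFinset, x, fun i => Metric.diam (T i) + e i, ?_, ?_, ?_⟩
  · intro i hi
    have hib : i ∈ b := by simpa using hi
    refine ⟨(hx i (hb hib)).2, by linarith [he i, Metric.diam_nonneg (s := T i)], ?_⟩
    linarith [hele i, hdiam' i, min_le_left (ε / 4) 1]
  · simpa using hbc
  · have s1 : ∑ i ∈ hbf.toFinset, Metric.diam (T i) ^ 2 ≤ ε / 4 := by
      rw [← ENNReal.ofReal_le_ofReal_iff (by linarith),
        ENNReal.ofReal_sum_of_nonneg fun i _ => by positivity]
      refine le_trans ?_ hsum.le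
      refine le_trans (Finset.sum_le_sum fun i hi => ?_) (ENNReal.sum_le_tsum hbf.toFinset)
      have hib : i ∈ b := by simpa using hi
      have hne : (T i).Nonempty := (hb hib).mono inter_subset_left
      rw [ciSup_pos hne, Metric.diam, ← ENNReal.toReal_pow, ENNReal.ofReal_toReal]
      · simp
      · exact ENNReal.pow_ne_top ((hdiam i).trans_lt ENNReal.ofReal_lt_top).ne
    have s2 : ∑ i ∈ hbf.toFinset, e i ≤ c := sum_le_hasSum _ (fun i _ => (he i).le) hec
    calc ∑ i ∈ hbf.toFinset, (Metric.diam (T i) + e i) ^ 2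
        ≤ ∑ i ∈ hbf.toFinset, (2 * Metric.diam (T i) ^ 2 + 2 * e i) := by
          refine Finset.sum_le_sum fun i _ => ?_
          have : e i ≤ 1 := by linarith [hele i, min_le_right (ε / 4) 1]
          nlinarith [sq_nonneg (Metric.diam (T i) - e i), he i]
      _ ≤ ε := by
          rw [Finset.sum_add_distrib, ← Finset.mul_sum, ← Finset.mul_sum]
          linarith [min_le_left (ε / 4) 1]

theorem norm_fderiv_prod_le {ι : Type*} (t : Finset ι) {a : ι → Space3 → ℝ}
    (ha : ∀ i ∈ t, Differentiable ℝ (a i)) (h01 : ∀ i ∈ t, ∀ x, a i x ∈ Icc (0 : ℝ) 1) (x : Space3) :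
    ‖fderiv ℝ (fun x => ∏ i ∈ t, a i x) x‖ ≤ ∑ i ∈ t, ‖fderiv ℝ (a i) x‖ := by
  classical
  rw [fderiv_finsetProd fun i hi => ha i hi x]
  refine norm_sum_le_of_le _ fun i hi => ?_
  rw [norm_smul, Real.norm_eq_abs, Finset.abs_prod]
  refine mul_le_of_le_one_left (norm_nonneg _) (Finset.prod_le_one (fun j _ => abs_nonneg _) ?_)
  intro j hj
  have := h01 j (Finset.mem_of_mem_erase hj) x
  rw [abs_of_nonneg this.1]
  exact this.2

/-- A compact set of zero area can be cut off at an arbitrarily small cost in total variation. -/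
theorem exists_cutoff {E : Set Space3} (hE : IsCompact E) (h0 : μHE[2] E = 0) {δ : ℝ}
    (hδ : 0 < δ) : ∃ χ : Space3 → ℝ, ContDiff ℝ 1 χ ∧ (∀ x, χ x ∈ Icc (0 : ℝ) 1) ∧
      (∀ x ∉ Metric.thickening δ E, χ x = 1) ∧ Disjoint (tsupport χ) E ∧
      Integrable (fun x => ‖fderiv ℝ χ x‖) ∧ ∫ x, ‖fderiv ℝ χ x‖ ≤ δ := by
  let φ : ContDiffBump (0 : Space3) := ⟨1, 2, one_pos, one_lt_two⟩
  set C := ∫ x, ‖fderiv ℝ φ x‖ with hC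
  have hC0 : 0 ≤ C := integral_nonneg fun x => norm_nonneg _
  have hφ : ContDiff ℝ 1 φ := φ.contDiff
  have hφi : Integrable fun x => ‖fderiv ℝ φ x‖ :=
    (hφ.continuous_fderiv one_ne_zero).norm.integrable_of_hasCompactSupport
      (φ.hasCompactSupport.fderiv ℝ).norm
  obtain ⟨t, x, r, hxr, hcov, hsum⟩ := exists_finite_ball_cover hE h0
    (ε := min (δ / 2) (δ / (C + 1))) (lt_min (by linarith) (by positivity))
  let a : ℕ → Space3 → ℝ := fun i y => 1 - φ ((r i)⁻¹ • (y - x i))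
  have ha : ∀ i, ContDiff ℝ 1 (a i) := fun i =>
    contDiff_const.sub (hφ.comp ((contDiff_id.sub contDiff_const).const_smul _))
  have ha01 : ∀ i y, a i y ∈ Icc (0 : ℝ) 1 := fun i y =>
    ⟨sub_nonneg.2 φ.le_one, sub_le_self _ φ.nonneg⟩
  have hda : ∀ i y, ‖fderiv ℝ (a i) y‖ = |(r i)⁻¹| * ‖fderiv ℝ φ ((r i)⁻¹ • (y - x i))‖ := by
    intro i y
    have h1 : HasFDerivAt (fun y => (r i)⁻¹ • (y - x i))
        ((r i)⁻¹ • ContinuousLinearMap.id ℝ Space3) y :=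
      HasFDerivAt.fun_const_smul ((hasFDerivAt_id y).sub_const (x i)) (r i)⁻¹
    have h2 := ((hφ.differentiable one_ne_zero
      ((r i)⁻¹ • (y - x i))).hasFDerivAt.comp y h1).const_sub 1
    rw [show fderiv ℝ (a i) y = _ from h2.fderiv, norm_neg, ContinuousLinearMap.comp_smul,
      ContinuousLinearMap.comp_id, norm_smul, Real.norm_eq_abs]
  have hdai : ∀ i ∈ t, Integrable fun y => ‖fderiv ℝ (a i) y‖ := by
    intro i hi
    simp only [hda]
    refine Integrable.const_mul ?_ _
    exact (hφi.comp_smul (inv_ne_zero (hxr i hi).2.1.ne')).comp_sub_right (x i)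
  have hdaint : ∀ i ∈ t, ∫ y, ‖fderiv ℝ (a i) y‖ = r i ^ 2 * C := by
    intro i hi
    have hr := (hxr i hi).2.1
    simp only [hda]
    rw [integral_const_mul, integral_sub_right_eq_self (fun y => ‖fderiv ℝ φ ((r i)⁻¹ • y)‖) (x i),
      Measure.integral_comp_smul volume (fun y => ‖fderiv ℝ φ y‖), ← hC]
    simp only [finrank_euclideanSpace, Fintype.card_fin, smul_eq_mul]
    rw [abs_of_pos (by positivity), abs_of_pos (by positivity)]
    field_simp
  have hbound : ∀ y, ‖fderiv ℝ (fun y => ∏ i ∈ t, a i y) y‖ ≤ ∑ i ∈ t, ‖fderiv ℝ (a i) y‖ :=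
    norm_fderiv_prod_le t (fun i _ => (ha i).differentiable one_ne_zero) (fun i _ => ha01 i)
  have hcd : ContDiff ℝ 1 fun y => ∏ i ∈ t, a i y := contDiff_prod fun i _ => ha i
  have hint : Integrable fun y => ‖fderiv ℝ (fun y => ∏ i ∈ t, a i y) y‖ := by
    refine (integrable_finsetSum t hdai).mono'
      (hcd.continuous_fderiv one_ne_zero).norm.aestronglyMeasurable (ae_of_all _ fun y => ?_)
    rw [norm_norm]
    exact hbound y
  refine ⟨fun y => ∏ i ∈ t, a i y, hcd, fun y => ⟨Finset.prod_nonneg fun i _ => (ha01 i y).1,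
    Finset.prod_le_one (fun i _ => (ha01 i y).1) fun i _ => (ha01 i y).2⟩, ?_, ?_, hint, ?_⟩
  · intro y hy
    refine Finset.prod_eq_one fun i hi => ?_
    obtain ⟨hxE, hr, hrδ⟩ := hxr i hi
    have hd : δ ≤ dist y (x i) := not_lt.1 fun h => hy (Metric.mem_thickening_iff.2 ⟨x i, hxE, h⟩)
    have : φ ((r i)⁻¹ • (y - x i)) = 0 := by
      refine φ.zero_of_le_dist ?_
      rw [dist_zero_right, norm_smul, norm_inv, Real.norm_of_nonneg hr.le, ← dist_eq_norm]
      change 2 ≤ _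
      rw [le_inv_mul_iff₀ hr]
      linarith [min_le_left (δ / 2) (δ / (C + 1))]
    simp only [a, this, sub_zero]
  · have hO : IsOpen (⋃ i ∈ t, Metric.ball (x i) (r i)) :=
      isOpen_biUnion fun i _ => Metric.isOpen_ball
    refine (Disjoint.closure_left ?_ hO).mono_right hcov
    rw [disjoint_left]
    intro y hy hyO
    obtain ⟨i, hi, hyi⟩ := mem_iUnion₂.1 hyO
    refine hy (Finset.prod_eq_zero hi ?_)
    have hr := (hxr i hi).2.1
    have : φ ((r i)⁻¹ • (y - x i)) = 1 := by
      refine φ.one_of_mem_closedBall ?_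
      rw [mem_closedBall_zero_iff, norm_smul, norm_inv, Real.norm_of_nonneg hr.le, ← dist_eq_norm]
      change _ ≤ 1
      rw [inv_mul_le_iff₀ hr, mul_one]
      exact (Metric.mem_ball.1 hyi).le
    simp only [a, this, sub_self]
  · calc _ ≤ ∫ y, ∑ i ∈ t, ‖fderiv ℝ (a i) y‖ :=
        integral_mono hint (integrable_finsetSum t hdai) hbound
      _ = (∑ i ∈ t, r i ^ 2) * C := by
        rw [integral_finsetSum t hdai, Finset.sum_mul]
        exact Finset.sum_congr rfl hdaint
      _ ≤ δ / (C + 1) * C := by gcongr; exact hsum.trans (min_le_right _ _)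
      _ ≤ δ := by
        rw [div_mul_eq_mul_div, div_le_iff₀ (by positivity)]
        nlinarith

theorem eq_of_forall_abs_sub_le_mul {a b C : ℝ} (h : ∀ ε : ℝ, 0 < ε → |a - b| ≤ ε * C) : a = b := by
  have lim : Filter.Tendsto (fun ε : ℝ => ε * C) (𝓝[>] 0) (𝓝 0) := by
    have : Continuous fun ε : ℝ => ε * C := by fun_prop
    simpa using (this.tendsto 0).mono_left nhdsWithin_le_nhds
  have := ge_of_tendsto lim (Filter.eventually_of_mem self_mem_nhdsWithin h)
  exact sub_eq_zero.1 (abs_nonpos_iff.1 this)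

theorem integrableOn_flux {K : Set Space3} (hK : IsCompact K) (hb : HasPiecewiseC1Boundary K)
    (w : Space3) {f : Space3 → ℝ} (hf : ContDiff ℝ 1 f) :
    IntegrableOn (fun x => inner ℝ (f x • w) (outwardUnitNormal K x)) (frontier K) μHE[2] :=
  integrableOn_inner_outwardUnitNormal hK hb (hf.continuous.smul continuous_const).continuousOn

/-- The divergence theorem for functions that vanish near the singular boundary points. -/
theorem setIntegral_fderiv_eq_of_disjoint {K : Set Space3} (hK : IsCompact K) (hb : HasPiecewiseC1Boundary K)
    (w : Space3) {f : Space3 → ℝ} (hf : ContDiff ℝ 1 f) (hfc : HasCompactSupport f)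
    (hE : Disjoint (tsupport f) (frontier K \ regularBoundary K)) :
    ∫ x in K, fderiv ℝ f x w =
      ∫ x in frontier K, inner ℝ (f x • w) (outwardUnitNormal K x) ∂μHE[2] := by
  refine eq_of_forall_abs_sub_le_mul (C := ∫ x in frontier K, |f x| ∂μHE[2]) fun ε hε => ?_
  have hex := fun (p : Space3) (hp : p ∈ tsupport f) =>
    exists_flux_approx hK hb w (disjoint_left.1 hE hp) hε
  choose! U hU hpU H using hex
  obtain ⟨t, ht, hcov⟩ := hfc.isCompact.elim_nhds_subcover U
    fun x hx => (hU x hx).mem_nhds (hpU x hx)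
  obtain ⟨ρ, hρ⟩ := SmoothPartitionOfUnity.exists_isSubordinate (modelWithCornersSelf ℝ Space3)
    (isClosed_tsupport f) (fun i : t => U i) (fun i => hU i (ht i i.2))
    (fun x hx => by
      obtain ⟨i, hi, hxi⟩ := mem_iUnion₂.1 (hcov hx)
      exact mem_iUnion.2 ⟨⟨i, hi⟩, hxi⟩)
  have hρd : ∀ i, ContDiff ℝ 1 (ρ i) := fun i =>
    (ρ i).contMDiff.contDiff.of_le (by exact_mod_cast le_top)
  have hsum : ∀ x, f x = ∑ i, ρ i x * f x := by
    intro x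
    rw [← Finset.sum_mul]
    by_cases hx : x ∈ tsupport f
    · rw [← finsum_eq_sum_of_fintype, ρ.sum_eq_one hx, one_mul]
    · rw [image_eq_zero_of_notMem_tsupport hx, mul_zero]
  have hgd : ∀ i, ContDiff ℝ 1 fun x => ρ i x * f x := fun i => (hρd i).mul hf
  have hgc : ∀ i, HasCompactSupport fun x => ρ i x * f x := fun i => hfc.mul_left
  have hgU : ∀ i, tsupport (fun x => ρ i x * f x) ⊆ U i := fun i =>
    (tsupport_mul_subset_left).trans (hρ i)
  have e1 : ∫ x in K, fderiv ℝ f x w = ∑ i, ∫ x in K, fderiv ℝ (fun x => ρ i x * f x) x w := by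
    rw [← integral_finsetSum _ fun i _ => (integrable_fderiv_apply (hgd i) (hgc i) w).restrict]
    refine integral_congr_ae (ae_of_all _ fun x => ?_)
    have : fderiv ℝ f x = ∑ i, fderiv ℝ (fun x => ρ i x * f x) x := by
      rw [← fderiv_fun_sum fun i _ => (hgd i).differentiable one_ne_zero x]
      congr 1
      exact funext hsum
    simp only [this, sum_apply]
  have e2 : ∫ x in frontier K, inner ℝ (f x • w) (outwardUnitNormal K x) ∂μHE[2] =
      ∑ i, ∫ x in frontier K, inner ℝ ((ρ i x * f x) • w) (outwardUnitNormal K x) ∂μHE[2] := by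
    rw [← integral_finsetSum _ fun i _ => integrableOn_flux hK hb w (hgd i)]
    refine integral_congr_ae (ae_of_all _ fun x => ?_)
    simp only
    rw [← sum_inner, ← Finset.sum_smul, ← hsum]
  have hfin : IsFiniteMeasure (μHE[2].restrict (frontier K)) :=
    isFiniteMeasure_restrict.2 hb.area_lt_top.ne
  have hfi : ∀ g : Space3 → ℝ, ContDiff ℝ 1 g → HasCompactSupport g →
      Integrable g (μHE[2].restrict (frontier K)) := by
    intro g hg hgc
    obtain ⟨C, hC⟩ := hgc.exists_bound_of_continuous hg.continuous
    exact Integrable.of_bound hg.continuous.aestronglyMeasurable C (ae_of_all _ hC)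
  have e3 : ∫ x in frontier K, |f x| ∂μHE[2] =
      ∑ i, ∫ x in frontier K, |ρ i x * f x| ∂μHE[2] := by
    rw [← integral_finsetSum _ fun i _ => (hfi _ (hgd i) (hgc i)).abs]
    refine integral_congr_ae (ae_of_all _ fun x => ?_)
    simp only [abs_mul, abs_of_nonneg (ρ.nonneg _ x)]
    rw [← Finset.sum_mul]
    by_cases hx : x ∈ tsupport f
    · rw [← finsum_eq_sum_of_fintype, ρ.sum_eq_one hx, one_mul]
    · rw [image_eq_zero_of_notMem_tsupport hx, abs_zero, mul_zero]
  rw [e1, e2, e3, ← Finset.sum_sub_distrib, Finset.mul_sum]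
  exact (Finset.abs_sum_le_sum_abs _ _).trans
    (Finset.sum_le_sum fun i _ => H i (ht i i.2) _ (hgd i) (hgc i) (hgU i))

/-- The divergence theorem for one component, on regions with piecewise `C¹` boundary. -/
theorem setIntegral_fderiv_eq {K : Set Space3} (hK : IsCompact K) (hb : HasPiecewiseC1Boundary K)
    (w : Space3) {f : Space3 → ℝ} (hf : ContDiff ℝ 1 f) (hfc : HasCompactSupport f) :
    ∫ x in K, fderiv ℝ f x w =
      ∫ x in frontier K, inner ℝ (f x • w) (outwardUnitNormal K x) ∂μHE[2] := by
  set E := frontier K \ regularBoundary K with hEdef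
  have hEc : IsClosed E := isClosed_frontier_diff_regularBoundary hK.isClosed
  have hEK : IsCompact E := hK.of_isClosed_subset hEc
    (sdiff_subset.trans hK.isClosed.frontier_subset)
  have hδ : ∀ k : ℕ, (0 : ℝ) < 1 / (k + 1) := fun k => by positivity
  choose χ hχd hχ01 hχ1 hχE hχi hχle using fun k : ℕ =>
    exists_cutoff hEK hb.area_singular (hδ k)
  have hlim : ∀ x ∉ E, Filter.Tendsto (fun k => χ k x) Filter.atTop (𝓝 1) := by
    intro x hx
    obtain ⟨r, hr, hrE⟩ := Metric.mem_nhds_iff.1 (hEc.isOpen_compl.mem_nhds hx)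
    refine tendsto_const_nhds.congr' ?_
    filter_upwards [(tendsto_one_div_add_atTop_nhds_zero_nat (𝕜 := ℝ)).eventually_lt_const hr]
      with k hk
    refine (hχ1 k x fun h => ?_).symm
    obtain ⟨z, hz, hxz⟩ := Metric.mem_thickening_iff.1 h
    exact hrE (Metric.mem_ball.2 (by rw [dist_comm]; exact hxz.trans hk)) hz
  have hgd : ∀ k, ContDiff ℝ 1 fun x => χ k x * f x := fun k => (hχd k).mul hf
  have hgc : ∀ k, HasCompactSupport fun x => χ k x * f x := fun k => hfc.mul_left
  have heq : ∀ k, ∫ x in K, fderiv ℝ (fun x => χ k x * f x) x w =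
      ∫ x in frontier K, inner ℝ ((χ k x * f x) • w) (outwardUnitNormal K x) ∂μHE[2] := fun k =>
    setIntegral_fderiv_eq_of_disjoint hK hb w (hgd k) (hgc k)
      ((hχE k).mono_left tsupport_mul_subset_left)
  have hint := integrable_fderiv_apply hf hfc w
  obtain ⟨C, hC⟩ := hfc.exists_bound_of_continuous hf.continuous
  have hC0 : 0 ≤ C := (norm_nonneg _).trans (hC 0)
  have h1 : Filter.Tendsto (fun k => ∫ x in K, χ k x * fderiv ℝ f x w) Filter.atTop
      (𝓝 (∫ x in K, fderiv ℝ f x w)) := by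
    refine tendsto_integral_of_dominated_convergence (fun x => ‖fderiv ℝ f x w‖)
      (fun k => ((hχd k).continuous.aestronglyMeasurable).mul hint.restrict.1)
      hint.restrict.norm (fun k => ae_of_all _ fun x => ?_) ?_
    · rw [norm_mul]
      refine mul_le_of_le_one_left (norm_nonneg _) ?_
      rw [Real.norm_of_nonneg (hχ01 k x).1]
      exact (hχ01 k x).2
    · have hE0 : volume E = 0 :=
        volume_eq_zero_of_area_lt_top (by rw [hb.area_singular]; exact ENNReal.zero_lt_top)
      filter_upwards [ae_restrict_of_ae (measure_eq_zero_iff_ae_notMem.1 hE0)] with x hx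
      simpa using (hlim x hx).mul_const (fderiv ℝ f x w)
  have hfχ : ∀ k x, ‖f x * fderiv ℝ (χ k) x w‖ ≤ C * ‖w‖ * ‖fderiv ℝ (χ k) x‖ := by
    intro k x
    rw [norm_mul]
    calc _ ≤ C * (‖fderiv ℝ (χ k) x‖ * ‖w‖) :=
        mul_le_mul (hC x) (ContinuousLinearMap.le_opNorm _ _) (norm_nonneg _) hC0
      _ = _ := by ring
  have hfχi : ∀ k, Integrable fun x => f x * fderiv ℝ (χ k) x w := fun k =>
    ((hχi k).const_mul (C * ‖w‖)).mono'
      (hf.continuous.mul (((hχd k).continuous_fderiv one_ne_zero).clm_apply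
        continuous_const)).aestronglyMeasurable (ae_of_all _ (hfχ k))
  have h2 : Filter.Tendsto (fun k => ∫ x in K, f x * fderiv ℝ (χ k) x w) Filter.atTop (𝓝 0) := by
    refine squeeze_zero_norm (a := fun k : ℕ => C * ‖w‖ * (1 / ((k : ℝ) + 1))) (fun k => ?_) ?_
    · calc _ ≤ ∫ x in K, C * ‖w‖ * ‖fderiv ℝ (χ k) x‖ :=
          norm_integral_le_of_norm_le ((hχi k).const_mul _).restrict (ae_of_all _ (hfχ k))
        _ ≤ ∫ x, C * ‖w‖ * ‖fderiv ℝ (χ k) x‖ :=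
          setIntegral_le_integral ((hχi k).const_mul _) (ae_of_all _ fun x => by positivity)
        _ ≤ _ := by
          rw [integral_const_mul]
          exact mul_le_mul_of_nonneg_left (hχle k) (by positivity)
    · simpa using (tendsto_one_div_add_atTop_nhds_zero_nat (𝕜 := ℝ)).const_mul (C * ‖w‖)
  have h3 : Filter.Tendsto (fun k => ∫ x in K, fderiv ℝ (fun x => χ k x * f x) x w) Filter.atTop
      (𝓝 (∫ x in K, fderiv ℝ f x w)) := by
    have h12 := h1.add h2
    rw [add_zero] at h12
    refine h12.congr fun k => ?_
    rw [← integral_add _ (hfχi k).restrict]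
    · refine integral_congr_ae (ae_of_all _ fun x => ?_)
      simp only
      rw [fderiv_fun_mul ((hχd k).differentiable one_ne_zero x) (hf.differentiable one_ne_zero x)]
      simp
    · refine hint.restrict.norm.mono' (((hχd k).continuous.aestronglyMeasurable).mul
        hint.restrict.1) (ae_of_all _ fun x => ?_)
      rw [norm_mul]
      refine mul_le_of_le_one_left (norm_nonneg _) ?_
      rw [Real.norm_of_nonneg (hχ01 k x).1]
      exact (hχ01 k x).2
  have hfl := integrableOn_flux hK hb w hf
  have h4 : Filter.Tendsto (fun k => ∫ x in frontier K,
      inner ℝ ((χ k x * f x) • w) (outwardUnitNormal K x) ∂μHE[2]) Filter.atTop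
      (𝓝 (∫ x in frontier K, inner ℝ (f x • w) (outwardUnitNormal K x) ∂μHE[2])) := by
    refine tendsto_integral_of_dominated_convergence
      (fun x => ‖inner ℝ (f x • w) (outwardUnitNormal K x)‖)
      (fun k => (integrableOn_flux hK hb w (hgd k)).1)
      hfl.norm (fun k => ae_of_all _ fun x => ?_) ?_
    · rw [mul_smul, real_inner_smul_left, norm_mul]
      refine mul_le_of_le_one_left (norm_nonneg _) ?_
      rw [Real.norm_of_nonneg (hχ01 k x).1]
      exact (hχ01 k x).2
    · filter_upwards [ae_restrict_of_ae (measure_eq_zero_iff_ae_notMem.1 hb.area_singular)]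
        with x hx
      simp only [mul_smul, real_inner_smul_left]
      simpa using (hlim x hx).mul_const (f x * inner ℝ w (outwardUnitNormal K x))
  exact tendsto_nhds_unique h3 (h4.congr fun k => (heq k).symm)

/-- The divergence theorem for regions with piecewise `C¹` boundary. -/
theorem setIntegral_divergence_eq_boundaryFlux {K : Set Space3} (hK : IsCompact K)
    (hb : HasPiecewiseC1Boundary K) {v : Space3 → Space3} {O : Set Space3} (hO : IsOpen O)
    (hKO : K ⊆ O) (hv : ContDiffOn ℝ 1 v O) :
    ∫ x in K, divergence v x = boundaryFlux K v := by
  obtain ⟨L, hL, hKL, hLO⟩ := exists_compact_between hK hO hKO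
  obtain ⟨χ, hχ⟩ := exists_contMDiffMap_one_nhds_of_subset_interior
    (n := 1) (modelWithCornersSelf ℝ Space3) hK.isClosed hKL
  obtain ⟨hχ1, hχ0, -⟩ := hχ
  have hχd : ContDiff ℝ 1 χ := χ.contMDiff.contDiff
  have hχs : tsupport χ ⊆ L :=
    closure_minimal (fun x hx => by_contra fun h => hx (hχ0 x h)) hL.isClosed
  have hχc : HasCompactSupport χ := hL.of_isClosed_subset (isClosed_tsupport _) hχs
  let f : Fin 3 → Space3 → ℝ := fun k x => χ x * v x k
  have hfd : ∀ k, ContDiff ℝ 1 (f k) := by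
    intro k
    rw [contDiff_iff_contDiffAt]
    intro x
    by_cases hx : x ∈ O
    · have h1 : ContDiffAt ℝ 1 (fun x => v x k) x :=
        (contDiff_euclidean.1 contDiff_id k).contDiffAt.comp x (hv.contDiffAt (hO.mem_nhds hx))
      exact hχd.contDiffAt.mul h1
    · have h1 : (tsupport χ)ᶜ ∈ 𝓝 x :=
        (isClosed_tsupport _).isOpen_compl.mem_nhds fun h => hx (hLO (hχs h))
      refine (contDiffAt_const (c := (0 : ℝ))).congr_of_eventuallyEq ?_
      filter_upwards [h1] with y hy
      simp only [f, image_eq_zero_of_notMem_tsupport hy, zero_mul]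
  have hfc : ∀ k, HasCompactSupport (f k) := fun k => hχc.mul_right
  have hχK : ∀ x ∈ K, ∀ᶠ y in 𝓝 x, χ y = 1 := fun x hx =>
    (Filter.eventually_iff_exists_mem.2 ⟨_, hχ1, fun _ h => h⟩ :
      ∀ᶠ y in 𝓝ˢ K, χ y = 1).filter_mono (nhds_le_nhdsSet hx)
  have e1 : ∀ x ∈ K, divergence v x = ∑ k, fderiv ℝ (f k) x (EuclideanSpace.single k 1) := by
    intro x hx
    refine Finset.sum_congr rfl fun k _ => ?_
    have h1 : f k =ᶠ[𝓝 x] fun y => v y k := by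
      filter_upwards [hχK x hx] with y hy
      simp only [f, hy, one_mul]
    have h2 : HasFDerivAt v (fderiv ℝ v x) x :=
      ((hv.contDiffAt (hO.mem_nhds (hKO hx))).differentiableAt one_ne_zero).hasFDerivAt
    have h3 : HasFDerivAt (fun y => v y k) ((EuclideanSpace.proj k).comp (fderiv ℝ v x)) x :=
      (EuclideanSpace.proj k : Space3 →L[ℝ] ℝ).hasFDerivAt.comp x h2
    rw [h1.fderiv_eq, h3.fderiv]
    rfl
  have hKf : frontier K ⊆ K := hK.isClosed.frontier_subset
  rw [setIntegral_congr_fun hK.measurableSet e1,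
    integral_finsetSum _ fun k _ => (integrable_fderiv_apply (hfd k) (hfc k) _).restrict]
  simp_rw [fun k => setIntegral_fderiv_eq hK hb (EuclideanSpace.single k 1) (hfd k) (hfc k)]
  rw [← integral_finsetSum _ fun k _ => integrableOn_flux hK hb _ (hfd k)]
  refine setIntegral_congr_fun isClosed_frontier.measurableSet fun x hx => ?_
  have h1 : χ x = 1 := (hχK x (hKf hx)).self_of_nhds
  simp only [f, h1, one_mul]
  rw [← sum_inner]
  congr 1
  ext k
  simp [Finset.sum_apply, Pi.single_apply]

/-! ### Diffeomorphic images of regions -/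

section Diffeomorphism

variable {D : Set Space3} {Φ ψ : Space3 → Space3} {S : Set Space3} {ξ : Space3}

theorem map_nhds_eq_of_det_ne_zero (hΦ : ContDiffAt ℝ 1 Φ ξ) (hdet : (fderiv ℝ Φ ξ).det ≠ 0) :
    Filter.map Φ (𝓝 ξ) = 𝓝 (Φ ξ) := by
  have h := hΦ.hasStrictFDerivAt one_ne_zero
  rw [← (fderiv ℝ Φ ξ).coe_toContinuousLinearEquivOfDetNeZero hdet] at h
  exact h.map_nhds_eq_of_equiv

theorem contDiffAt_leftInverse (hD : IsOpen D) (hξ : ξ ∈ D) (hΦ : ContDiffAt ℝ 1 Φ ξ)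
    (hdet : (fderiv ℝ Φ ξ).det ≠ 0) (hψ : ∀ η ∈ D, ψ (Φ η) = η) : ContDiffAt ℝ 1 ψ (Φ ξ) := by
  have h : HasFDerivAt Φ
      ((fderiv ℝ Φ ξ).toContinuousLinearEquivOfDetNeZero hdet : Space3 →L[ℝ] Space3) ξ := by
    rw [ContinuousLinearMap.coe_toContinuousLinearEquivOfDetNeZero]
    exact (hΦ.differentiableAt one_ne_zero).hasFDerivAt
  have hinv := hΦ.to_localInverse h one_ne_zero
  refine hinv.congr_of_eventuallyEq ?_
  have h1 : ∀ᶠ y in 𝓝 (Φ ξ), hΦ.localInverse h one_ne_zero y ∈ D := by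
    refine hinv.continuousAt.eventually_mem (hD.mem_nhds ?_)
    rw [hΦ.localInverse_apply_image h one_ne_zero]
    exact hξ
  have h2 : ∀ᶠ y in 𝓝 (Φ ξ), Φ (hΦ.localInverse h one_ne_zero y) = y :=
    (hΦ.hasStrictFDerivAt' h one_ne_zero).eventually_right_inverse
  filter_upwards [h1, h2] with y hy1 hy2
  rw [← hψ _ hy1, hy2]

theorem frontier_image_eq (hD : IsOpen D) (hinj : InjOn Φ D) (hc : ContinuousOn Φ D)
    (hmap : ∀ ξ ∈ D, Filter.map Φ (𝓝 ξ) = 𝓝 (Φ ξ)) (hS : IsCompact S) (hSD : S ⊆ D) :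
    frontier (Φ '' S) = Φ '' frontier S := by
  have hint : ∀ ξ ∈ S, (Φ ξ ∈ interior (Φ '' S) ↔ ξ ∈ interior S) := by
    intro ξ hξ
    rw [mem_interior_iff_mem_nhds, mem_interior_iff_mem_nhds, ← hmap ξ (hSD hξ), Filter.mem_map]
    constructor
    · intro h
      filter_upwards [h, hD.mem_nhds (hSD hξ)] with η h1 h2
      obtain ⟨ζ, hζ, he⟩ := h1
      rwa [← hinj (hSD hζ) h2 he]
    · intro h
      filter_upwards [h] with η hη
      exact mem_image_of_mem _ hη
  rw [(hS.image_of_continuousOn (hc.mono hSD)).isClosed.frontier_eq, hS.isClosed.frontier_eq]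
  ext x
  constructor
  · rintro ⟨⟨ξ, hξ, rfl⟩, h⟩
    exact ⟨ξ, ⟨hξ, fun h' => h ((hint ξ hξ).2 h')⟩, rfl⟩
  · rintro ⟨ξ, ⟨hξ, h⟩, rfl⟩
    exact ⟨mem_image_of_mem _ hξ, fun h' => h ((hint ξ hξ).1 h')⟩

theorem IsLocalDefiningFunction.image {g : Space3 → ℝ} (hg : IsLocalDefiningFunction S ξ g)
    (hD : IsOpen D) (hξ : ξ ∈ D) (hSD : S ⊆ D) (hΦ : ContDiffAt ℝ 1 Φ ξ)
    (hdet : (fderiv ℝ Φ ξ).det ≠ 0) (hψ : ∀ η ∈ D, ψ (Φ η) = η) :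
    IsLocalDefiningFunction (Φ '' S) (Φ ξ) (g ∘ ψ) := by
  have hψd := contDiffAt_leftInverse hD hξ hΦ hdet hψ
  have hgψ : ContDiffAt ℝ 1 (g ∘ ψ) (Φ ξ) :=
    ContDiffAt.comp _ (by rw [hψ ξ hξ]; exact hg.contDiffAt) hψd
  refine ⟨hgψ, by rw [Function.comp_apply, hψ ξ hξ, hg.map_eq_zero], ?_, ?_⟩
  · intro h0
    have h1 : fderiv ℝ (g ∘ ψ) (Φ ξ) = 0 := by
      rwa [gradient, map_eq_zero_iff _ (LinearIsometryEquiv.injective _)] at h0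
    have h2 : g =ᶠ[𝓝 ξ] (g ∘ ψ) ∘ Φ := by
      filter_upwards [hD.mem_nhds hξ] with η hη
      simp only [Function.comp_apply, hψ η hη]
    refine hg.gradient_ne_zero ?_
    rw [gradient, h2.fderiv_eq, fderiv_comp ξ (hgψ.differentiableAt one_ne_zero)
      (hΦ.differentiableAt one_ne_zero), h1, ContinuousLinearMap.zero_comp, map_zero]
  · rw [← map_nhds_eq_of_det_ne_zero hΦ hdet, Filter.eventually_map]
    filter_upwards [hg.mem_iff, hD.mem_nhds hξ] with η h1 h2
    rw [Function.comp_apply, hψ η h2, ← h1]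
    constructor
    · rintro ⟨ζ, hζ, he⟩
      rwa [← hψ η h2, ← he, hψ ζ (hSD hζ)]
    · exact mem_image_of_mem _

theorem HasPiecewiseC1Boundary.image (hb : HasPiecewiseC1Boundary S) (hS : IsCompact S)
    (hSD : S ⊆ D) (hD : IsOpen D) (hΦ : ContDiffOn ℝ 1 Φ D)
    (hdet : ∀ ξ ∈ D, (fderiv ℝ Φ ξ).det ≠ 0) (hψ : ∀ η ∈ D, ψ (Φ η) = η) :
    HasPiecewiseC1Boundary (Φ '' S) := by
  have hΦ' : ∀ ξ ∈ D, ContDiffAt ℝ 1 Φ ξ := fun ξ hξ => hΦ.contDiffAt (hD.mem_nhds hξ)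
  have hinj : InjOn Φ D := fun a ha b hb hab => by rw [← hψ a ha, hab, hψ b hb]
  have hfr : frontier (Φ '' S) = Φ '' frontier S := frontier_image_eq hD hinj hΦ.continuousOn
    (fun ξ hξ => map_nhds_eq_of_det_ne_zero (hΦ' ξ hξ) (hdet ξ hξ)) hS hSD
  have hfS : frontier S ⊆ S := hS.isClosed.frontier_subset
  obtain ⟨c, hc⟩ : ∃ c, LipschitzOnWith c Φ S := by
    refine LocallyLipschitzOn.exists_lipschitzOnWith_of_compact hS fun ξ hξ => ?_
    obtain ⟨c, t, ht, hl⟩ := (hΦ' ξ (hSD hξ)).exists_lipschitzOnWith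
    exact ⟨c, t, nhdsWithin_le_nhds ht, hl⟩
  constructor
  · rw [hfr]
    refine (area_image_le (hc.mono hfS)).trans_lt ?_
    exact ENNReal.mul_lt_top (ENNReal.pow_lt_top ENNReal.coe_lt_top) hb.area_lt_top
  · have hsub : frontier (Φ '' S) \ regularBoundary (Φ '' S) ⊆
        Φ '' (frontier S \ regularBoundary S) := by
      rw [hfr]
      rintro _ ⟨⟨ξ, hξ, rfl⟩, h⟩
      refine ⟨ξ, ⟨hξ, fun ⟨g, hg⟩ => h ⟨g ∘ ψ, ?_⟩⟩, rfl⟩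
      have hξD := hSD (hfS hξ)
      exact hg.image hD hξD hSD (hΦ' ξ hξD) (hdet ξ hξD) hψ
    refine measure_mono_null hsub (le_antisymm ?_ zero_le)
    refine (area_image_le (hc.mono (sdiff_subset.trans hfS))).trans ?_
    rw [hb.area_singular, mul_zero]

end Diffeomorphism

/-! ### The determinant of a linear map of space -/

theorem det_eq_entries (L : Space3 →L[ℝ] Space3) :
    L.det = (Matrix.of fun i j : Fin 3 => L (EuclideanSpace.single j 1) i).det := by
  rw [ContinuousLinearMap.det, ← LinearMap.det_toMatrix (EuclideanSpace.basisFun (Fin 3) ℝ).toBasis]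
  congr 1

theorem contDiff_det : ContDiff ℝ 1 fun L : Space3 →L[ℝ] Space3 => L.det := by
  have entry : ∀ i j : Fin 3, ContDiff ℝ 1 fun L : Space3 →L[ℝ] Space3 =>
      L (EuclideanSpace.single j 1) i := fun i j =>
    ((EuclideanSpace.proj i : Space3 →L[ℝ] ℝ).contDiff).comp
      (contDiff_id.clm_apply contDiff_const)
  simp only [det_eq_entries, Matrix.det_fin_three, Matrix.of_apply]
  exact ((((((entry 0 0).mul (entry 1 1)).mul (entry 2 2)).sub
    (((entry 0 0).mul (entry 1 2)).mul (entry 2 1))).sub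
    (((entry 0 1).mul (entry 1 0)).mul (entry 2 2))).add
    (((entry 0 1).mul (entry 1 2)).mul (entry 2 0))).add
    (((entry 0 2).mul (entry 1 0)).mul (entry 2 1)) |>.sub
    (((entry 0 2).mul (entry 1 1)).mul (entry 2 0))

theorem hasDerivAt_det_of_eq_id {M : ℝ → Space3 →L[ℝ] Space3} {M' : Space3 →L[ℝ] Space3} {t : ℝ}
    (hM : HasDerivAt M M' t) (h1 : M t = ContinuousLinearMap.id ℝ Space3) :
    HasDerivAt (fun s => (M s).det) (∑ k : Fin 3, M' (EuclideanSpace.single k 1) k) t := by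
  have entry : ∀ i j : Fin 3, HasDerivAt (fun s => M s (EuclideanSpace.single j 1) i)
      (M' (EuclideanSpace.single j 1) i) t := fun i j =>
    (EuclideanSpace.proj i : Space3 →L[ℝ] ℝ).hasFDerivAt.comp_hasDerivAt t
      (by simpa using hM.clm_apply (hasDerivAt_const t (EuclideanSpace.single j (1 : ℝ))))
  simp only [det_eq_entries, Matrix.det_fin_three, Matrix.of_apply]
  have h := ((((((entry 0 0).fun_mul (entry 1 1)).fun_mul (entry 2 2)).fun_sub
    (((entry 0 0).fun_mul (entry 1 2)).fun_mul (entry 2 1))).fun_sub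
    (((entry 0 1).fun_mul (entry 1 0)).fun_mul (entry 2 2))).fun_add
    (((entry 0 1).fun_mul (entry 1 2)).fun_mul (entry 2 0))).fun_add
    (((entry 0 2).fun_mul (entry 1 0)).fun_mul (entry 2 1)) |>.fun_sub
    (((entry 0 2).fun_mul (entry 1 1)).fun_mul (entry 2 0))
  refine h.congr_deriv ?_
  simp [h1, Fin.sum_univ_three]

namespace FluidMotion

variable (F : FluidMotion)

/-- The motion as a function on space-time. -/
def flow (q : Space3 × ℝ) : Space3 := F.pos q.1 q.2

/-- The deformation gradient `∂x(ξ, t)/∂ξ`. -/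
def gradPos (q : Space3 × ℝ) : Space3 →L[ℝ] Space3 :=
  (fderiv ℝ F.flow q).comp (ContinuousLinearMap.inl ℝ Space3 ℝ)

variable {F} {ξ : Space3}

theorem isOpen_domain_prod : IsOpen (F.domain ×ˢ (univ : Set ℝ)) := F.isOpen_domain.prod isOpen_univ

theorem contDiffAt_flow (hξ : ξ ∈ F.domain) (t : ℝ) : ContDiffAt ℝ 3 F.flow (ξ, t) :=
  F.contDiffOn.contDiffAt (isOpen_domain_prod.mem_nhds ⟨hξ, mem_univ t⟩)

theorem hasFDerivAt_flow (hξ : ξ ∈ F.domain) (t : ℝ) :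
    HasFDerivAt F.flow (fderiv ℝ F.flow (ξ, t)) (ξ, t) :=
  ((contDiffAt_flow hξ t).differentiableAt (by norm_num)).hasFDerivAt

theorem hasFDerivAt_pos (hξ : ξ ∈ F.domain) (t : ℝ) :
    HasFDerivAt (fun η => F.pos η t) (F.gradPos (ξ, t)) ξ :=
  HasFDerivAt.comp (g := F.flow) (f := fun η => (η, t)) ξ (hasFDerivAt_flow hξ t)
    (hasFDerivAt_prodMk_left ξ t)

theorem deriv_pos (hξ : ξ ∈ F.domain) (t : ℝ) :
    deriv (fun s => F.pos ξ s) t = fderiv ℝ F.flow (ξ, t) (0, 1) := by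
  have h : HasDerivAt (fun s : ℝ => (ξ, s)) ((0 : Space3), (1 : ℝ)) t :=
    (hasDerivAt_const t ξ).prodMk (hasDerivAt_id t)
  exact ((hasFDerivAt_flow hξ t).comp_hasDerivAt t h).deriv

theorem contDiffAt_fderiv_flow (hξ : ξ ∈ F.domain) (t : ℝ) :
    ContDiffAt ℝ 2 (fderiv ℝ F.flow) (ξ, t) :=
  (contDiffAt_flow hξ t).fderiv_right (by norm_num)

theorem contDiffAt_gradPos (hξ : ξ ∈ F.domain) (t : ℝ) : ContDiffAt ℝ 2 F.gradPos (ξ, t) :=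
  (contDiffAt_fderiv_flow hξ t).clm_comp contDiffAt_const

theorem contDiffAt_pos (hξ : ξ ∈ F.domain) (t : ℝ) : ContDiffAt ℝ 1 (fun η => F.pos η t) ξ :=
  ((contDiffAt_flow hξ t).of_le (by norm_num)).comp ξ (contDiffAt_id.prodMk contDiffAt_const)

theorem det_gradPos_pos (hξ : ξ ∈ F.domain) (t : ℝ) : 0 < (F.gradPos (ξ, t)).det := by
  have hc : Continuous fun s : ℝ => (F.gradPos (ξ, s)).det := by
    refine continuous_iff_continuousAt.2 fun s => ?_
    have h1 : ContinuousAt F.gradPos (ξ, s) := (contDiffAt_gradPos hξ s).continuousAt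
    exact ContinuousLinearMap.continuous_det.continuousAt.comp
      (ContinuousAt.comp (f := fun s : ℝ => (ξ, s)) h1 (by fun_prop))
  have hne : ∀ s, (F.gradPos (ξ, s)).det ≠ 0 := fun s => by
    rw [← (hasFDerivAt_pos hξ s).fderiv]
    exact F.jacobian_ne_zero ξ hξ s
  have h0 : (F.gradPos (ξ, 0)).det = 1 := by
    have h1 : (fun η => F.pos η 0) =ᶠ[𝓝 ξ] id := by
      filter_upwards [F.isOpen_domain.mem_nhds hξ] with η hη
      exact F.pos_zero η hη
    rw [← (hasFDerivAt_pos hξ 0).fderiv, h1.fderiv_eq, fderiv_id, ContinuousLinearMap.det]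
    exact LinearMap.det_id
  by_contra hneg
  obtain ⟨s, -, hs⟩ := isPreconnected_univ.intermediate_value (mem_univ t) (mem_univ 0)
    hc.continuousOn (show (0 : ℝ) ∈ Icc _ _ from ⟨not_lt.1 hneg, by rw [h0]; exact zero_le_one⟩)
  exact hne s hs

theorem contDiffAt_label (hξ : ξ ∈ F.domain) (t : ℝ) : ContDiffAt ℝ 1 (F.label t) (F.pos ξ t) :=
  contDiffAt_leftInverse (Φ := fun η => F.pos η t) F.isOpen_domain hξ (contDiffAt_pos hξ t)
    (F.jacobian_ne_zero ξ hξ t) fun _ hη => F.label_pos hη t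

theorem map_pos_nhds (hξ : ξ ∈ F.domain) (t : ℝ) :
    Filter.map (fun η => F.pos η t) (𝓝 ξ) = 𝓝 (F.pos ξ t) :=
  map_nhds_eq_of_det_ne_zero (contDiffAt_pos hξ t) (F.jacobian_ne_zero ξ hξ t)

theorem isOpen_region_domain (t : ℝ) : IsOpen (F.region F.domain t) := by
  rw [isOpen_iff_mem_nhds]
  rintro _ ⟨ξ, hξ, rfl⟩
  rw [← map_pos_nhds hξ t]
  exact Filter.image_mem_map (F.isOpen_domain.mem_nhds hξ)

theorem contDiffAt_velocity (hξ : ξ ∈ F.domain) (t : ℝ) :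
    ContDiffAt ℝ 1 (F.velocity t) (F.pos ξ t) := by
  have h1 : ContDiffAt ℝ 1 (fun x => fderiv ℝ F.flow (F.label t x, t) ((0 : Space3), (1 : ℝ)))
      (F.pos ξ t) := by
    refine ContDiffAt.clm_apply ?_ contDiffAt_const
    refine ContDiffAt.comp (g := fderiv ℝ F.flow) (f := fun x => (F.label t x, t)) _ ?_
      ((contDiffAt_label hξ t).prodMk contDiffAt_const)
    rw [F.label_pos hξ]
    exact (contDiffAt_fderiv_flow hξ t).of_le (by norm_num)
  refine h1.congr_of_eventuallyEq ?_
  filter_upwards [(isOpen_region_domain t).mem_nhds (mem_image_of_mem _ hξ)]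
  rintro _ ⟨η, hη, rfl⟩
  simp only [F.label_pos hη]
  rw [← deriv_pos hη t]
  exact F.velocity_pos hη t

/-- The material derivative of the deformation gradient is the velocity gradient. -/
theorem hasDerivAt_gradPos (hξ : ξ ∈ F.domain) (t : ℝ) :
    HasDerivAt (fun s => F.gradPos (ξ, s))
      ((fderiv ℝ (F.velocity t) (F.pos ξ t)).comp (F.gradPos (ξ, t))) t := by
  have hd : HasFDerivAt (fderiv ℝ F.flow) (fderiv ℝ (fderiv ℝ F.flow) (ξ, t)) (ξ, t) :=
    ((contDiffAt_fderiv_flow hξ t).differentiableAt two_ne_zero).hasFDerivAt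
  have hline : HasDerivAt (fun s : ℝ => (ξ, s)) ((0 : Space3), (1 : ℝ)) t :=
    (hasDerivAt_const t ξ).prodMk (hasDerivAt_id t)
  have h1 : HasDerivAt (fun s => F.gradPos (ξ, s))
      ((fderiv ℝ (fderiv ℝ F.flow) (ξ, t) (0, 1)).comp (ContinuousLinearMap.inl ℝ Space3 ℝ)) t := by
    have := (hd.comp_hasDerivAt t hline).clm_comp
      (hasDerivAt_const t (ContinuousLinearMap.inl ℝ Space3 ℝ))
    rw [ContinuousLinearMap.comp_zero, add_zero] at this
    exact this
  refine h1.congr_deriv ?_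
  have h2 : HasFDerivAt (fun η => fderiv ℝ F.flow (η, t) ((0 : Space3), (1 : ℝ)))
      (((fderiv ℝ (fderiv ℝ F.flow) (ξ, t)).comp (ContinuousLinearMap.inl ℝ Space3 ℝ)).flip
        (0, 1)) ξ := by
    have := (HasFDerivAt.comp (g := fderiv ℝ F.flow) (f := fun η => (η, t)) ξ hd
      (hasFDerivAt_prodMk_left ξ t)).clm_apply
      (hasFDerivAt_const ((0 : Space3), (1 : ℝ)) ξ)
    simpa using this
  have h3 : (fun η => fderiv ℝ F.flow (η, t) ((0 : Space3), (1 : ℝ))) =ᶠ[𝓝 ξ]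
      F.velocity t ∘ fun η => F.pos η t := by
    filter_upwards [F.isOpen_domain.mem_nhds hξ] with η hη
    rw [Function.comp_apply, F.velocity_pos hη, deriv_pos hη]
  have h4 : HasFDerivAt (F.velocity t ∘ fun η => F.pos η t)
      ((fderiv ℝ (F.velocity t) (F.pos ξ t)).comp (F.gradPos (ξ, t))) ξ :=
    ((contDiffAt_velocity hξ t).differentiableAt one_ne_zero).hasFDerivAt.comp ξ
      (hasFDerivAt_pos hξ t)
  rw [← (h2.congr_of_eventuallyEq h3.symm).unique h4]
  have hsymm : IsSymmSndFDerivAt ℝ F.flow (ξ, t) :=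
    (contDiffAt_flow hξ t).isSymmSndFDerivAt (by simp; norm_num)
  ext1 v
  exact hsymm (0, 1) (v, 0)

/-- Euler's expansion formula. -/
theorem hasDerivAt_det_gradPos (hξ : ξ ∈ F.domain) (t : ℝ) :
    HasDerivAt (fun s => (F.gradPos (ξ, s)).det)
      (divergence (F.velocity t) (F.pos ξ t) * (F.gradPos (ξ, t)).det) t := by
  have hne : (F.gradPos (ξ, t)).det ≠ 0 := (det_gradPos_pos hξ t).ne'
  let e := (F.gradPos (ξ, t)).toContinuousLinearEquivOfDetNeZero hne
  have he : (F.gradPos (ξ, t)).comp (e.symm : Space3 →L[ℝ] Space3)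
      = ContinuousLinearMap.id ℝ Space3 := by
    ext1 v
    exact e.apply_symm_apply v
  have he' : (e.symm : Space3 →L[ℝ] Space3).comp (F.gradPos (ξ, t))
      = ContinuousLinearMap.id ℝ Space3 := by
    ext1 v
    exact e.symm_apply_apply v
  have h1 : HasDerivAt (fun s => (F.gradPos (ξ, s)).comp (e.symm : Space3 →L[ℝ] Space3))
      (fderiv ℝ (F.velocity t) (F.pos ξ t)) t := by
    have h := (hasDerivAt_gradPos hξ t).clm_comp
      (hasDerivAt_const t (e.symm : Space3 →L[ℝ] Space3))
    rw [ContinuousLinearMap.comp_zero, add_zero, ContinuousLinearMap.comp_assoc, he,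
      ContinuousLinearMap.comp_id] at h
    exact h
  have h2 := (hasDerivAt_det_of_eq_id h1 he).mul_const (F.gradPos (ξ, t)).det
  refine h2.congr_of_eventuallyEq (Filter.Eventually.of_forall fun s => ?_)
  have h3 : F.gradPos (ξ, s) = ((F.gradPos (ξ, s)).comp (e.symm : Space3 →L[ℝ] Space3)).comp
      (F.gradPos (ξ, t)) := by
    rw [ContinuousLinearMap.comp_assoc, he', ContinuousLinearMap.comp_id]
  exact (congrArg ContinuousLinearMap.det h3).trans (LinearMap.det_comp _ _)

theorem isCompact_region {S : Set Space3} (hS : IsCompact S) (hSF : S ⊆ F.domain) (t : ℝ) :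
    IsCompact (F.region S t) :=
  hS.image_of_continuousOn fun _ hξ =>
    (contDiffAt_pos (hSF hξ) t).continuousAt.continuousWithinAt

theorem contDiffOn_velocity (t : ℝ) : ContDiffOn ℝ 1 (F.velocity t) (F.region F.domain t) := by
  rintro _ ⟨ξ, hξ, rfl⟩
  exact (contDiffAt_velocity hξ t).contDiffWithinAt

theorem continuousOn_divergence (t : ℝ) :
    ContinuousOn (divergence (F.velocity t)) (F.region F.domain t) := by
  rintro _ ⟨ξ, hξ, rfl⟩
  have h := (contDiffAt_velocity hξ t).continuousAt_fderiv one_ne_zero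
  refine ContinuousAt.continuousWithinAt ?_
  unfold divergence
  refine tendsto_finsetSum _ fun k _ => ?_
  exact (EuclideanSpace.proj k : Space3 →L[ℝ] ℝ).continuous.continuousAt.comp
    (h.clm_apply continuousAt_const)

/-- Change of variables to the initial positions. -/
theorem integral_region {S : Set Space3} (hS : IsCompact S) (hSF : S ⊆ F.domain) (t : ℝ)
    (v : Space3 → ℝ) :
    ∫ x in F.region S t, v x = ∫ ξ in S, v (F.pos ξ t) * (F.gradPos (ξ, t)).det := by
  rw [region, integral_image_eq_integral_abs_det_fderiv_smul volume hS.measurableSet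
    (fun ξ hξ => (hasFDerivAt_pos (hSF hξ) t).hasFDerivWithinAt) ((F.injOn t).mono hSF)]
  refine setIntegral_congr_fun hS.measurableSet fun ξ hξ => ?_
  simp only [abs_of_pos (det_gradPos_pos (hSF hξ) t), smul_eq_mul, mul_comm]

theorem hasDerivAt_regionVolume {S : Set Space3} (hS : IsCompact S) (hSF : S ⊆ F.domain) (t : ℝ) :
    HasDerivAt (F.regionVolume S) (∫ x in F.region S t, divergence (F.velocity t) x) t := by
  have hV : F.regionVolume S = fun s => ∫ ξ in S, (F.gradPos (ξ, s)).det := by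
    funext s
    rw [regionVolume, integral_region hS hSF]
    simp only [one_mul]
  have hJ : ContDiffOn ℝ 1 (fun q => (F.gradPos q).det) (F.domain ×ˢ (univ : Set ℝ)) := by
    rintro ⟨ξ, s⟩ ⟨hξ, -⟩
    exact (contDiff_det.contDiffAt.comp (ξ, s)
      ((contDiffAt_gradPos (F := F) (ξ := ξ) hξ s).of_le (by norm_num))).contDiffWithinAt
  have hJd : ∀ ξ ∈ F.domain, ∀ s, divergence (F.velocity s) (F.pos ξ s) * (F.gradPos (ξ, s)).det
      = fderiv ℝ (fun q => (F.gradPos q).det) (ξ, s) (0, 1) := by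
    intro ξ hξ s
    have h1 : HasDerivAt (fun s : ℝ => (ξ, s)) ((0 : Space3), (1 : ℝ)) s :=
      (hasDerivAt_const s ξ).prodMk (hasDerivAt_id s)
    have h2 := ((hJ.contDiffAt (x := (ξ, s)) (isOpen_domain_prod.mem_nhds
      ⟨hξ, mem_univ s⟩)).differentiableAt one_ne_zero).hasFDerivAt
    exact (hasDerivAt_det_gradPos hξ s).unique (h2.comp_hasDerivAt s h1)
  have hJc : ContinuousOn
      (fun q => fderiv ℝ (fun q => (F.gradPos q).det) q ((0 : Space3), (1 : ℝ)))
      (F.domain ×ˢ (univ : Set ℝ)) :=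
    (hJ.continuousOn_fderiv_of_isOpen isOpen_domain_prod le_rfl).clm_apply continuousOn_const
  obtain ⟨C, hC⟩ := (hS.prod (isCompact_Icc (a := t - 1) (b := t + 1))).exists_bound_of_continuousOn
    (hJc.mono (prod_mono hSF (subset_univ _)))
  have hslice : ∀ s : ℝ, ContinuousOn (fun ξ : Space3 => (ξ, s)) S := fun s =>
    continuousOn_id.prodMk continuousOn_const
  have hmaps : ∀ s : ℝ, MapsTo (fun ξ : Space3 => (ξ, s)) S (F.domain ×ˢ univ) := fun s ξ hξ =>
    ⟨hSF hξ, mem_univ s⟩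
  have hJs : ∀ s, ContinuousOn (fun ξ => (F.gradPos (ξ, s)).det) S := fun s =>
    hJ.continuousOn.comp (hslice s) (hmaps s)
  have hfin : IsFiniteMeasure ((volume : Measure Space3).restrict S) :=
    isFiniteMeasure_restrict.2 hS.measure_lt_top.ne
  rw [hV, integral_region hS hSF,
    setIntegral_congr_fun hS.measurableSet fun ξ hξ => hJd ξ (hSF hξ) t]
  refine (hasDerivAt_integral_of_dominated_loc_of_deriv_le (bound := fun _ => C)
    (F := fun s ξ => (F.gradPos (ξ, s)).det)
    (F' := fun s ξ => fderiv ℝ (fun q => (F.gradPos q).det) (ξ, s) ((0 : Space3), (1 : ℝ)))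
    (Icc_mem_nhds (sub_one_lt t) (lt_add_one t))
    (Filter.Eventually.of_forall fun s => (hJs s).aestronglyMeasurable hS.measurableSet)
    ((hJs t).integrableOn_compact hS)
    ((hJc.comp (hslice t) (hmaps t)).aestronglyMeasurable hS.measurableSet)
    ?_ (integrable_const _) ?_).2
  · exact (ae_restrict_iff' hS.measurableSet).2 (ae_of_all _ fun ξ hξ s hs => hC (ξ, s) ⟨hξ, hs⟩)
  · refine (ae_restrict_iff' hS.measurableSet).2 (ae_of_all _ fun ξ hξ s _ => ?_)
    rw [← hJd ξ (hSF hξ) s]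
    exact hasDerivAt_det_gradPos (hSF hξ) s

end FluidMotion

end

/-- The change of volume of a region moving with a fluid. -/
theorem mainTheorem12 (F : FluidMotion) (S : Set Space3) (hS : IsCompact S)
    (hSF : S ⊆ F.domain) :
    (∀ t : ℝ,
      IntegrableOn (divergence (F.velocity t)) (F.region S t) volume ∧
      HasDerivAt (F.regionVolume S) (∫ x in F.region S t, divergence (F.velocity t) x) t) ∧
    (HasPiecewiseC1Boundary S → ∀ t : ℝ,
      HasPiecewiseC1Boundary (F.region S t) ∧
      IntegrableOn (fun x => inner ℝ (F.velocity t x) (outwardUnitNormal (F.region S t) x))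
        (frontier (F.region S t)) μHE[2] ∧
      (∫ x in F.region S t, divergence (F.velocity t) x)
        = boundaryFlux (F.region S t) (F.velocity t)) := by
  have hsub : ∀ t, F.region S t ⊆ F.region F.domain t := fun t => image_mono hSF
  have hK : ∀ t, IsCompact (F.region S t) := FluidMotion.isCompact_region hS hSF
  refine ⟨fun t => ⟨((FluidMotion.continuousOn_divergence t).mono (hsub t)).integrableOn_compact
    (hK t), FluidMotion.hasDerivAt_regionVolume hS hSF t⟩, fun hb t => ?_⟩
  have hb' : HasPiecewiseC1Boundary (F.region S t) :=
    hb.image hS hSF F.isOpen_domain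
      (fun ξ hξ => (FluidMotion.contDiffAt_pos hξ t).contDiffWithinAt)
      (fun ξ hξ => F.jacobian_ne_zero ξ hξ t) fun ξ hξ => F.label_pos hξ t
  have hv := FluidMotion.contDiffOn_velocity (F := F) t
  exact ⟨hb', integrableOn_inner_outwardUnitNormal (hK t) hb'
      (hv.continuousOn.mono ((hK t).isClosed.frontier_subset.trans (hsub t))),
    setIntegral_divergence_eq_boundaryFlux (hK t) hb' (FluidMotion.isOpen_region_domain t)
      (hsub t) hv⟩
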